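/- Conventions. A permutation group on a graph is a pair $(H,\mathcal G)$ with $\mathcal G$ a graph and $H\leqslant\operatorname{Aut}(\mathcal G)$. The direct product of such pairs is $\prod_{i\in I}(H_i,\mathcal G_i)=\bigl(\prod_{i\in I}H_i,\bigoplus_{i\in I}\mathcal G_i\bigr)$, where $\bigoplus$ is the disjoint union of graphs and $\prod_i H_i$ acts on it componentwise. For $G\leqslant A$, the normaliser tower of $G$ in $A$ is given by $N_0(G)=G$, $N_{\gamma+1}(G)=N_A(N_\gamma(G))$, and $N_\lambda(G)=\bigcup_{\gamma<\lambda}N_\gamma(G)$ for limit ordinals $\lambda$. It terminates in exactly $\tau$ steps if $\tau$ is the least ordinal such that $N_\gamma(G)=N_\tau(G)$ for all $\gamma>\tau$; then $N_\tau(G)$ is its terminal group. Let $\Gamma$ be a connected rigid graph (rigid: $\operatorname{Aut}(\Gamma)=1$). Define $(H_0,\mathcal G_0)=(F_0,\mathcal G_0)=(\operatorname{Aut}(\Gamma),\Gamma)$ and, by recursion on ordinals $\alpha>0$, $$(H_\alpha,\mathcal G_\alpha)=(F_0,\mathcal G_0)\times\prod_{\gamma<\alpha}(F_\gamma,\mathcal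 G_\gamma),$$ with $F_\alpha$ the terminal group of the normaliser tower of $H_\alpha$ in $\operatorname{Aut}(\mathcal G_\alpha)$. For ordinals $1\le\beta<\alpha$ put $$(D^\alpha_\beta,\mathcal G^\alpha_\beta)=(H_\alpha,\mathcal G_\alpha)\times(F_\beta,\mathcal G_\beta)\times(F_\beta,\mathcal G_\beta).$$ Statement. If $\Gamma$ is a connected rigid graph and $1\le\beta<\alpha$ are ordinals, then the normaliser tower of $D^\alpha_\beta$ in $\operatorname{Aut}(\mathcal G^\alpha_\beta)$ terminates in exactly $\beta$ steps. Moreover, let $\Gamma'=\mathcal G_\beta\oplus\mathcal G_\beta\oplus\mathcal G_\beta$, $B=F_\beta\times F_\beta\times F_\beta\leqslant\operatorname{Aut}(\Gamma')$, and let $F_\beta\operatorname{wr}\operatorname{Sym}(3)=B\rtimes\operatorname{Sym}(3)\leqslant\operatorname{Aut}(\Gamma')$, where $\operatorname{Sym}(3)$ permutes the three copies of $\mathcal G_\beta$. Then there is a graph isomorphism $$\varphi:\mathcal G^\alpha_\beta\to\mathcal G_\beta\oplus\Gamma'\oplus\bigoplus_{\beta<\gamma<\alpha}\mathcal G_\gamma$$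 such that conjugation by $\varphi$ carries $D^\alpha_\beta$ onto the group of $$(H_\beta,\mathcal G_\beta)\times(B,\Gamma')\times\prod_{\beta<\gamma<\alpha}(F_\gamma,\mathcal G_\gamma)$$ and carries the terminal group of the normaliser tower of $D^\alpha_\beta$ onto the group of $$(F_\beta,\mathcal G_\beta)\times(F_\beta\operatorname{wr}\operatorname{Sym}(3),\Gamma')\times\prod_{\beta<\gamma<\alpha}(F_\gamma,\mathcal G_\gamma).$$ -/

import Mathlib

universe u v

/-! ### Normaliser towers -/

section NormaliserTower

variable {A : Type u} [Group A]

/-- The normaliser tower of `G` in the ambient group `A`: start with `G`, take the normaliser in `A`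
at successor steps, and unions at limit steps (see `mem_normTower_limit`: the supremum of subgroups
used at limits is the union). -/
noncomputable def normTower (G : Subgroup A) (α : Ordinal.{u}) : Subgroup A :=
  Ordinal.limitRecOn α G (fun _ N => Subgroup.normalizer (N : Set A))
    (fun o _ N => ⨆ x : Set.Iio o, N x.1 x.2)

theorem normTower_zero (G : Subgroup A) : normTower G 0 = G :=
  Ordinal.limitRecOn_zero ..

theorem normTower_succ (G : Subgroup A) (α : Ordinal.{u}) :
    normTower G (α + 1) = Subgroup.normalizer (normTower G α : Set A) :=
  Ordinal.limitRecOn_add_one ..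

theorem normTower_limit (G : Subgroup A) {α : Ordinal.{u}} (h : Order.IsSuccLimit α) :
    normTower G α = ⨆ x : Set.Iio α, normTower G x.1 :=
  Ordinal.limitRecOn_limit _ _ _ _ h

theorem normTower_mono (G : Subgroup A) : Monotone (normTower G) := by
  intro a b hab
  induction b using Ordinal.limitRecOn with
  | zero => rw [nonpos_iff_eq_zero.1 hab]
  | add_one b ih =>
    rcases hab.eq_or_lt with rfl | h
    · exact le_rfl
    · rw [normTower_succ]
      exact (ih (Order.lt_add_one_iff.1 h)).trans Subgroup.le_normalizer
  | limit b hb ih =>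
    rcases hab.eq_or_lt with rfl | h
    · exact le_rfl
    · rw [normTower_limit G hb]
      exact le_iSup (fun x : Set.Iio b => normTower G x.1) ⟨a, h⟩

theorem mem_normTower_limit (G : Subgroup A) {α : Ordinal.{u}} (h : Order.IsSuccLimit α) {g : A} :
    g ∈ normTower G α ↔ ∃ β < α, g ∈ normTower G β := by
  have : Nonempty (Set.Iio α) := ⟨⟨0, h.bot_lt⟩⟩
  have hd : Directed (· ≤ ·) fun x : Set.Iio α => normTower G x.1 :=
    Monotone.directed_le fun x y hxy => normTower_mono G hxy
  rw [normTower_limit G h, Subgroup.mem_iSup_of_directed hd]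
  simp

/-- The normaliser tower of `G` terminates in exactly `α` steps: `α` is the least ordinal after
which the tower is constant. -/
def TerminatesInExactly (G : Subgroup A) (α : Ordinal.{u}) : Prop :=
  IsLeast {δ : Ordinal.{u} | ∀ γ, δ < γ → normTower G γ = normTower G δ} α

theorem exists_normTower_stable (G : Subgroup A) :
    ∃ δ : Ordinal.{u}, ∀ γ, δ < γ → normTower G γ = normTower G δ := by
  by_contra! h
  have hmono : ∀ δ : Ordinal.{u}, normTower G δ < normTower G (δ + 1) := by
    intro δ
    refine lt_of_le_of_ne (normTower_mono G (le_of_lt (Order.lt_add_one_iff.2 le_rfl))) fun he => ?_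
    obtain ⟨γ, hγ, hne⟩ := h δ
    refine hne ?_
    have key : ∀ γ, δ ≤ γ → normTower G γ = normTower G δ := by
      intro γ
      induction γ using Ordinal.limitRecOn with
      | zero => intro h0; rw [nonpos_iff_eq_zero.1 h0]
      | add_one b ih =>
        intro hb
        rcases hb.eq_or_lt with rfl | hb
        · rfl
        · rw [normTower_succ, ih (Order.lt_add_one_iff.1 hb), ← normTower_succ, ← he]
      | limit b hb ih =>
        intro hδ
        rcases hδ.eq_or_lt with rfl | hδ
        · rfl
        · refine le_antisymm (fun g hg => ?_) (normTower_mono G hδ.le)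
          obtain ⟨c, hc, hg⟩ := (mem_normTower_limit G hb).1 hg
          rcases le_total δ c with h1 | h1
          · rwa [ih c hc h1] at hg
          · exact normTower_mono G h1 hg
    exact key γ hγ.le
  have hs : StrictMono (normTower G) := fun a b hab =>
    (hmono a).trans_le (normTower_mono G (Order.add_one_le_of_lt hab))
  exact not_injective_of_ordinal (normTower G) hs.injective

/-- The exact number of steps in which the normaliser tower of `G` terminates. -/
noncomputable def towerHeight (G : Subgroup A) : Ordinal.{u} :=
  sInf {δ : Ordinal.{u} | ∀ γ, δ < γ → normTower G γ = normTower G δ}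

theorem terminatesInExactly_towerHeight (G : Subgroup A) :
    TerminatesInExactly G (towerHeight G) :=
  ⟨csInf_mem (exists_normTower_stable G), fun _ h => csInf_le' h⟩

/-- The terminal group of the normaliser tower of `G`. -/
noncomputable def terminalGroup (G : Subgroup A) : Subgroup A :=
  normTower G (towerHeight G)

end NormaliserTower

/-! ### Permutation groups acting on graphs -/

/-- A graph is rigid if the identity is its only automorphism. -/
def IsRigid {V : Type u} (Γ : SimpleGraph V) : Prop :=
  ∀ g : Γ ≃g Γ, g = 1

/-- A pair `(H, 𝒢)` consisting of a graph `𝒢` and a subgroup `H` of `Aut(𝒢)`. -/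
structure PermGraph : Type (u + 1) where
  /-- the vertex set -/
  V : Type u
  /-- the graph -/
  graph : SimpleGraph V
  /-- the group of automorphisms -/
  grp : Subgroup (graph ≃g graph)

/-- The direct sum (disjoint union) of a family of graphs. -/
def graphSum {ι : Type v} {V : ι → Type u} (Γ : ∀ i, SimpleGraph (V i)) :
    SimpleGraph (Σ i, V i) where
  Adj x y := ∃ (i : ι) (a b : V i), (Γ i).Adj a b ∧ x = ⟨i, a⟩ ∧ y = ⟨i, b⟩
  symm := ⟨fun _ _ ⟨i, a, b, h, hx, hy⟩ => ⟨i, b, a, h.symm, hy, hx⟩⟩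
  loopless := ⟨by
    rintro _ ⟨i, a, b, h, rfl, hy⟩
    obtain rfl : a = b := by simpa using hy
    exact h.ne rfl⟩

namespace PermGraph

/-- The direct product `(H × K, 𝒢 ⊕ ℋ)` of `(H, 𝒢)` and `(K, ℋ)`: here `H × K` consists of the
automorphisms of `𝒢 ⊕ ℋ` that act as an element of `H` on `𝒢` and as an element of `K` on `ℋ`. -/
def prod (P Q : PermGraph.{u}) : PermGraph.{u} where
  V := P.V ⊕ Q.V
  graph := P.graph ⊕g Q.graph
  grp :=
    { carrier := {g | ∃ a ∈ P.grp, ∃ b ∈ Q.grp,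
        (∀ x, g (Sum.inl x) = Sum.inl (a x)) ∧ ∀ y, g (Sum.inr y) = Sum.inr (b y)}
      one_mem' := ⟨1, one_mem _, 1, one_mem _, fun _ => rfl, fun _ => rfl⟩
      mul_mem' := by
        rintro g g' ⟨a, ha, b, hb, h1, h2⟩ ⟨a', ha', b', hb', h1', h2'⟩
        exact ⟨a * a', mul_mem ha ha', b * b', mul_mem hb hb',
          fun x => by simp [RelIso.mul_apply, h1, h1'], fun x => by simp [RelIso.mul_apply, h2, h2']⟩
      inv_mem' := by
        rintro g ⟨a, ha, b, hb, h1, h2⟩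
        refine ⟨a⁻¹, inv_mem ha, b⁻¹, inv_mem hb, fun x => g.injective ?_, fun x => g.injective ?_⟩
        · rw [RelIso.apply_inv_self, h1, RelIso.apply_inv_self]
        · rw [RelIso.apply_inv_self, h2, RelIso.apply_inv_self] }

/-- The direct product `(∏ i, H i, ⨁ i, 𝒢 i)` of a family `(H i, 𝒢 i)`: here `∏ i, H i` consists of
the automorphisms that act on each `𝒢 i` as an element of `H i`. -/
def pi {ι : Type v} (P : ι → PermGraph.{u}) : PermGraph.{max v u} where
  V := Σ i, (P i).V
  graph := graphSum fun i => (P i).graph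
  grp :=
    { carrier := {g | ∃ h : ∀ i, (P i).graph ≃g (P i).graph, (∀ i, h i ∈ (P i).grp) ∧
        ∀ i x, g ⟨i, x⟩ = ⟨i, h i x⟩}
      one_mem' := ⟨fun _ => 1, fun _ => one_mem _, fun _ _ => rfl⟩
      mul_mem' := by
        rintro g g' ⟨a, ha, h⟩ ⟨a', ha', h'⟩
        exact ⟨fun i => a i * a' i, fun i => mul_mem (ha i) (ha' i),
          fun i x => by rw [RelIso.mul_apply, h', h, RelIso.mul_apply]⟩
      inv_mem' := by
        rintro g ⟨a, ha, h⟩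
        refine ⟨fun i => (a i)⁻¹, fun i => inv_mem (ha i), fun i x => g.injective ?_⟩
        rw [RelIso.apply_inv_self, h, RelIso.apply_inv_self] }

/-- The wreath product `H wr Sym(ι) = (∏ i : ι, H) ⋊ Sym(ι)` acting on the direct sum of copies of
`𝒢` indexed by `ι`: the automorphisms that send the copy `i` to the copy `σ i` by an element of `H`,
for some permutation `σ` of `ι`. -/
def wreathSym (ι : Type v) (P : PermGraph.{u}) : PermGraph.{max v u} where
  V := Σ _ : ι, P.V
  graph := graphSum fun _ : ι => P.graph
  grp :=
    { carrier := {g | ∃ (σ : Equiv.Perm ι) (h : ι → (P.graph ≃g P.graph)), (∀ i, h i ∈ P.grp) ∧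
        ∀ i x, g ⟨i, x⟩ = ⟨σ i, h i x⟩}
      one_mem' := ⟨1, fun _ => 1, fun _ => one_mem _, fun _ _ => rfl⟩
      mul_mem' := by
        rintro g g' ⟨σ, a, ha, h⟩ ⟨σ', a', ha', h'⟩
        exact ⟨σ * σ', fun i => a (σ' i) * a' i, fun i => mul_mem (ha _) (ha' i),
          fun i x => by rw [RelIso.mul_apply, h', h, RelIso.mul_apply, Equiv.Perm.mul_apply]⟩
      inv_mem' := by
        rintro g ⟨σ, a, ha, h⟩
        refine ⟨σ⁻¹, fun i => (a (σ⁻¹ i))⁻¹, fun i => inv_mem (ha _), fun i x => g.injective ?_⟩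
        rw [RelIso.apply_inv_self, h, RelIso.apply_inv_self]
        simp }

/-- The same graph with the terminal group of the normaliser tower of `H` in `Aut(𝒢)`. -/
noncomputable def terminal (P : PermGraph.{u}) : PermGraph.{u} where
  V := P.V
  graph := P.graph
  grp := terminalGroup P.grp

/-- The isomorphism of graphs `φ` is an isomorphism of permutation groups: conjugation by `φ` carries
the group of `P` onto the group of `Q`. -/
def IsPermIso {P Q : PermGraph.{u}} (φ : P.graph ≃g Q.graph) : Prop :=
  ∀ g : P.graph ≃g P.graph, g ∈ P.grp ↔ (φ.symm.trans g).trans φ ∈ Q.grp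

end PermGraph

/-! ### The groups `H_α(Γ)`, `F_α(Γ)` and `D^α_β(Γ)` -/

section Construction

variable {V : Type u} (Γ : SimpleGraph V)

/-- `(H_α(Γ), 𝒢_α(Γ))`, by recursion on `α`: it is `(Aut(Γ), Γ)` for `α = 0`, and
`(F_0, 𝒢_0) × ∏_{β < α} (F_β, 𝒢_β)` for `α > 0`, where `F_β` is the terminal group of the normaliser
tower of `H_β` in `Aut(𝒢_β)` and `F_0 = H_0`. -/
noncomputable def towerH (α : Ordinal.{u}) : PermGraph.{u} :=
  open Classical in
  if α = 0 then ⟨V, Γ, ⊤⟩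
  else PermGraph.prod ⟨V, Γ, ⊤⟩
    (PermGraph.pi fun i : Shrink.{u} (Set.Iio α) =>
      (towerH ((equivShrink (Set.Iio α)).symm i).1).terminal)
termination_by α
decreasing_by exact ((equivShrink (Set.Iio α)).symm i).2

/-- `(F_α(Γ), 𝒢_α(Γ))`. -/
noncomputable def towerF (α : Ordinal.{u}) : PermGraph.{u} :=
  (towerH Γ α).terminal

/-- The direct product of the `(F_γ(Γ), 𝒢_γ(Γ))` for `γ` in a set of ordinals. -/
noncomputable def prodF (s : Set Ordinal.{u}) [Small.{u} s] : PermGraph.{u} :=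
  PermGraph.pi fun i : Shrink.{u} s => towerF Γ ((equivShrink s).symm i).1

theorem towerH_zero : towerH Γ 0 = ⟨V, Γ, ⊤⟩ := by
  rw [towerH, if_pos rfl]

theorem towerF_zero : towerF Γ 0 = ⟨V, Γ, ⊤⟩ := by
  have : ∀ {A : Type u} [Group A], terminalGroup (⊤ : Subgroup A) = ⊤ := fun {A _} =>
    top_unique ((normTower_zero (⊤ : Subgroup A)).symm.le.trans (normTower_mono _ zero_le))
  rw [towerF, towerH_zero, PermGraph.terminal, this]

theorem towerH_of_pos {α : Ordinal.{u}} (h : 0 < α) :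
    towerH Γ α = (towerF Γ 0).prod (prodF Γ (Set.Iio α)) := by
  rw [towerH, if_neg h.ne', towerF_zero]
  rfl

/-- `(D^α_β(Γ), 𝒢^α_β(Γ)) = (H_α, 𝒢_α) × (F_β, 𝒢_β) × (F_β, 𝒢_β)`. -/
noncomputable def towerD (α β : Ordinal.{u}) : PermGraph.{u} :=
  ((towerH Γ α).prod (towerF Γ β)).prod (towerF Γ β)

end Construction

-- Every graph involved is a disjoint union of copies of `Γ`. As `Γ` is connected and rigid, the
-- automorphism group of such a union is the full symmetric group on the set of copies
-- (`liftEquiv`), so everything becomes a question about permutation groups on an index set.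
--
-- The copies in `𝒢_α` are indexed by the finite sets of ordinals below `α`. Sorting these by their
-- maximum reproduces the recursion: `∅` is the factor `Γ`, and the sets with maximum `γ` are a copy
-- of the index set of `𝒢_γ`. The maximum of the symmetric difference is an ultrametric, and `H_α`
-- preserves the maximum of each set and the distances between sets of equal maximum. Let stage `γ`
-- be the group obtained when maxima below `γ` are no longer distinguished. Each colour class has as
-- distances an initial segment of the ordinals (with `⊥` for zero) and is so homogeneous that its
-- isometry group determines the metric: equal distances form orbits on pairs, the ultrametric
-- inequality recovers their order, and an order automorphism of a well-ordered initial segment is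
-- trivial. Hence the normaliser of a stage consists of the permutations that permute the colours
-- and preserve the distances inside them (`IsHomogeneous.mem_normalizer_iff`). At stage `γ` the
-- classes "maximum below `γ`" and "maximum `γ`" are isometric, while every other class has a larger
-- range of distances. So the normaliser merges exactly these two, whose mutual distance is `γ`, and
-- is stage `γ + 1` (`normalizer_stage`). At stage `α` one colour is left, and `F_α` is the full
-- isometry group.
--
-- For `D^α_β` the two extra factors are further copies, with labels 1 and 2, of the family of sets
-- with maximum `β`; points with different labels have distance `β`. The first normaliser step also
-- merges the three isometric families with maximum `β`. From then on that class contains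
-- equilateral triangles of side `β`, which no class with a single label does, so it can never be
-- interchanged with another class. Three labels matter here: with two, the class would attain the
-- same distances as the class with maximum `β + 1` without containing such a triangle. The merging
-- therefore proceeds as before up to stage `β`, where the only possible partner of "maximum below
-- `β`" is the class with triangles, and it stops (`normalizer_stage_self`). Regrouping the labelled
-- sets by maximum instead of by label gives the isomorphism `φ`, and stage `β` is visibly `F_β`
-- times the wreath product times the untouched factors.

universe w

/-! ### Reading off a normaliser tower from a chain in an isomorphic group, possibly in another
universe -/

section NormaliserTower

/-- If the tower is constant after `δ`, then its terminal group is the `δ`-th group. -/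
theorem terminalGroup_eq_of_stable {A : Type u} [Group A] {G : Subgroup A} {δ : Ordinal.{u}}
    (h : ∀ γ, δ < γ → normTower G γ = normTower G δ) : terminalGroup G = normTower G δ := by
  have hle : towerHeight G ≤ δ := csInf_le' h
  rcases hle.eq_or_lt with he | hlt
  · rw [terminalGroup, he]
  · exact ((terminatesInExactly_towerHeight G).1 δ hlt).symm

/-- The tower is constant after the first self-normalising group. -/
theorem normTower_stable_of_normalizer_eq {A : Type u} [Group A] {G : Subgroup A} {δ : Ordinal.{u}}
    (h : Subgroup.normalizer (normTower G δ : Set A) = normTower G δ) (γ : Ordinal.{u})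
    (hγ : δ ≤ γ) : normTower G γ = normTower G δ := by
  induction γ using Ordinal.limitRecOn with
  | zero => rw [nonpos_iff_eq_zero.1 hγ]
  | add_one b ih =>
    rcases hγ.eq_or_lt with rfl | hb
    · rfl
    · rw [normTower_succ, ih (Order.lt_add_one_iff.1 hb), h]
  | limit b hb ih =>
    rcases hγ.eq_or_lt with rfl | hδ
    · rfl
    · refine le_antisymm (fun g hg => ?_) (normTower_mono G hδ.le)
      obtain ⟨c, hc, hg⟩ := (mem_normTower_limit G hb).1 hg
      rcases le_total δ c with h1 | h1
      · rwa [ih c hc h1] at hg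
      · exact normTower_mono G h1 hg

/-- A continuous chain of iterated normalisers in a group isomorphic to `A` computes the
normaliser tower in `A`. -/
theorem normTower_map_eq {A : Type u} [Group A] {B : Type v} [Group B] (L : B ≃* A)
    (S : Ordinal.{u} → Subgroup B) (τ : Ordinal.{u})
    (hsucc : ∀ γ < τ, Subgroup.normalizer (S γ : Set B) = S (γ + 1))
    (hmono : ∀ γ δ, γ ≤ δ → δ ≤ τ → S γ ≤ S δ)
    (hlim : ∀ δ ≤ τ, Order.IsSuccLimit δ → ∀ g ∈ S δ, ∃ γ < δ, g ∈ S γ)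
    (γ : Ordinal.{u}) (hγ : γ ≤ τ) :
    normTower ((S 0).map L.toMonoidHom) γ = (S γ).map L.toMonoidHom := by
  induction γ using Ordinal.limitRecOn with
  | zero => rw [normTower_zero]
  | add_one b ih =>
    have hb : b < τ := Order.add_one_le_iff.1 hγ
    rw [normTower_succ, ih hb.le, ← hsucc b hb]
    exact (Subgroup.map_equiv_normalizer_eq _ L).symm
  | limit b hb ih =>
    ext g
    rw [mem_normTower_limit _ hb]
    constructor
    · rintro ⟨c, hc, hg⟩
      rw [ih c hc (hc.le.trans hγ)] at hg
      exact Subgroup.map_mono (hmono c b hc.le hγ) hg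
    · rintro ⟨s, hs, rfl⟩
      obtain ⟨c, hc, hs⟩ := hlim b hγ hb s hs
      refine ⟨c, hc, ?_⟩
      rw [ih c hc (hc.le.trans hγ)]
      exact ⟨s, hs, rfl⟩

end NormaliserTower

/-! ### Normalisers of isometry groups of homogeneous coloured ultrametric spaces -/

section ColorIsom

variable {X : Type u} {C : Type v} {D : Type w}

/-- The permutations that preserve a colouring `c` and the distance `d` between any two points of
the same colour. -/
def colorIsom (c : X → C) (d : X → X → D) : Subgroup (Equiv.Perm X) where
  carrier := {g | (∀ x, c (g x) = c x) ∧ ∀ x y, c x = c y → d (g x) (g y) = d x y}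
  one_mem' := ⟨fun _ => rfl, fun _ _ _ => rfl⟩
  mul_mem' := by
    rintro g h ⟨hg, hg'⟩ ⟨hh, hh'⟩
    refine ⟨fun x => by rw [Equiv.Perm.mul_apply, hg, hh], fun x y hxy => ?_⟩
    rw [Equiv.Perm.mul_apply, Equiv.Perm.mul_apply, hg' _ _ (by rw [hh, hh, hxy]), hh' _ _ hxy]
  inv_mem' := by
    rintro g ⟨hg, hg'⟩
    have key : ∀ x, c (g⁻¹ x) = c x := fun x => by
      simpa using (hg (g⁻¹ x)).symm
    refine ⟨key, fun x y hxy => ?_⟩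
    simpa using (hg' (g⁻¹ x) (g⁻¹ y) (by rw [key, key, hxy])).symm

theorem mem_colorIsom {c : X → C} {d : X → X → D} {g : Equiv.Perm X} :
    g ∈ colorIsom c d ↔ (∀ x, c (g x) = c x) ∧ ∀ x y, c x = c y → d (g x) (g y) = d x y :=
  Iff.rfl

/-- The group `colorIsom c d` depends only on the partition into colours and on the distances inside
each colour. -/
theorem mem_colorIsom_congr {X' : Type*} {C' : Type*} {c : X → C} {c' : X' → C'}
    {d : X → X → D} {d' : X' → X' → D} (f : X ≃ X')
    (hc : ∀ x y, c x = c y ↔ c' (f x) = c' (f y))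
    (hd : ∀ x y, c x = c y → d x y = d' (f x) (f y)) (g : Equiv.Perm X) :
    g ∈ colorIsom c d ↔ f.permCongr g ∈ colorIsom c' d' := by
  simp only [mem_colorIsom, f.surjective.forall, Equiv.permCongr_apply, Equiv.symm_apply_apply,
    ← hc]
  exact and_congr_right fun h => forall₃_congr fun x y hxy => by
    rw [hd _ _ hxy, hd _ _ (by rw [h, h, hxy])]

/-- The colour classes are ultrametric spaces, any two points of the same colour are interchangeable
over the points equidistant from them, and the distances from a point form an initial segment. -/
structure IsHomogeneous [LinearOrder D] [OrderBot D] (c : X → C) (d : X → X → D) : Prop where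
  eq_bot : ∀ x y, d x y = ⊥ ↔ x = y
  symm : ∀ x y, d x y = d y x
  ultra : ∀ x y z, c x = c y → c y = c z → d x z ≤ max (d x y) (d y z)
  swap : ∀ y y', c y = c y' → ∃ g ∈ colorIsom c d, g y = y' ∧
    ∀ x, c x = c y → d x y = d x y' → x ≠ y → g x = x
  sat : ∀ x y e, c x = c y → e < d x y → ∃ z, c z = c x ∧ d x z = e

namespace IsHomogeneous

variable [LinearOrder D] [OrderBot D] {c : X → C} {d : X → X → D}

/-- Two-point homogeneity: after moving `x` to `x'`, the image of `y` and the target `y'` are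
equidistant from `x'`, so the second swap fixes `x'`. -/
theorem exists_map_pair (H : IsHomogeneous c d) {x y x' y' : X} (hxy : c x = c y)
    (hxx : c x = c x') (hxy' : c x' = c y') (hd : d x y = d x' y') :
    ∃ g ∈ colorIsom c d, g x = x' ∧ g y = y' := by
  obtain ⟨g, hg, hgx, -⟩ := H.swap x x' hxx
  have hd' : d x' (g y) = d x' y' := by rw [← hgx, hg.2 _ _ hxy, hd, hgx]
  by_cases hx : x' = g y
  · refine ⟨g, hg, hgx, ?_⟩
    rw [(H.eq_bot _ _).2 hx] at hd'
    rw [← hx, (H.eq_bot _ _).1 hd'.symm]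
  · have hc : c (g y) = c y' := by rw [hg.1, ← hxy, hxx, hxy']
    obtain ⟨k, hk, hky, hkx⟩ := H.swap (g y) y' hc
    exact ⟨k * g, mul_mem hk hg, by
      rw [Equiv.Perm.mul_apply, hgx, hkx _ (hxy'.trans hc.symm) hd' hx], by
      rw [Equiv.Perm.mul_apply, hky]⟩

/-- The colour classes are the orbits of the group, and a normalising permutation permutes orbits.
-/
theorem color_map_iff (H : IsHomogeneous c d) {h : Equiv.Perm X}
    (hh : h ∈ Subgroup.normalizer (colorIsom c d : Set (Equiv.Perm X))) {x y : X}
    (hxy : c x = c y) : c (h x) = c (h y) := by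
  obtain ⟨g, hg, hgx, -⟩ := H.swap x y hxy
  have := ((Subgroup.mem_normalizer_iff.1 hh g).1 hg).1 (h x)
  simpa [hgx] using this.symm

/-- Pairs at equal distance lie in one orbit on pairs, and `h` carries such orbits to orbits. So `h`
preserves equality of distances, though not yet their values. -/
theorem dist_map_eq (H : IsHomogeneous c d) {h : Equiv.Perm X}
    (hh : h ∈ Subgroup.normalizer (colorIsom c d : Set (Equiv.Perm X))) {x y x' y' : X}
    (hxy : c x = c y) (hxx : c x = c x') (hxy' : c x' = c y') (hd : d x y = d x' y') :
    d (h x) (h y) = d (h x') (h y') := by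
  obtain ⟨g, hg, hgx, hgy⟩ := H.exists_map_pair hxy hxx hxy' hd
  have := ((Subgroup.mem_normalizer_iff.1 hh g).1 hg).2 (h x) (h y) (H.color_map_iff hh hxy)
  simpa [hgx, hgy] using this.symm

/-- Equality of distances determines their order: `x` and `y` are equidistant from the farther point
`z`, this passes to the images, and the ultrametric inequality bounds the image of the short side.
Strictness comes from applying `dist_map_eq` to the inverse. -/
theorem dist_map_lt (H : IsHomogeneous c d) {h : Equiv.Perm X}
    (hh : h ∈ Subgroup.normalizer (colorIsom c d : Set (Equiv.Perm X))) {x y z : X}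
    (hxy : c x = c y) (hxz : c x = c z) (hlt : d x y < d x z) :
    d (h x) (h y) < d (h x) (h z) := by
  have hyz : d y z = d x z := by
    refine le_antisymm ?_ ?_
    · refine (H.ultra y x z hxy.symm hxz).trans ?_
      rw [H.symm y x, max_eq_right hlt.le]
    · by_contra! hc
      exact absurd ((H.ultra x y z hxy (hxy.symm.trans hxz))) (not_le.2 (max_lt hlt hc))
  have hcx := H.color_map_iff hh hxy
  have hcz := H.color_map_iff hh hxz
  have h1 := H.dist_map_eq hh (hxy.symm.trans hxz) hxy.symm hxz hyz
  refine lt_of_le_of_ne ?_ fun he => ?_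
  · refine (H.ultra _ _ _ hcz (hcz.symm.trans hcx)).trans ?_
    rw [H.symm (h z) (h y), h1, max_self]
  · have := H.dist_map_eq (inv_mem hh) hcx rfl hcz he
    exact hlt.ne (by simpa using this)

/-- A strictly monotone map on a well-ordered initial segment never lies below the identity; `sat`
realises every smaller distance by a point. -/
theorem le_dist_map [WellFoundedLT D] (H : IsHomogeneous c d) {h : Equiv.Perm X}
    (hh : h ∈ Subgroup.normalizer (colorIsom c d : Set (Equiv.Perm X))) {x y : X}
    (hxy : c x = c y) : d x y ≤ d (h x) (h y) := by
  have key : ∀ e y, c x = c y → d x y = e → e ≤ d (h x) (h y) := by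
    intro e
    induction e using WellFoundedLT.induction with
    | ind e ih =>
      intro y hxy he
      refine le_of_forall_lt fun e' he' => ?_
      obtain ⟨z, hz, hd⟩ := H.sat x y e' hxy (he ▸ he')
      exact (ih e' he' z hz.symm hd).trans_lt
        (H.dist_map_lt hh hz.symm hxy (by rwa [hd, he]))
  exact key _ y hxy rfl

/-- The normaliser of the group preserving the colours and the distances inside each colour consists
of the permutations that permute the colours and preserve the distances inside each colour. -/
theorem mem_normalizer_iff [WellFoundedLT D] (H : IsHomogeneous c d) {h : Equiv.Perm X} :
    h ∈ Subgroup.normalizer (colorIsom c d : Set (Equiv.Perm X)) ↔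
      (∀ x y, c (h x) = c (h y) ↔ c x = c y) ∧ ∀ x y, c x = c y → d (h x) (h y) = d x y := by
  constructor
  · intro hh
    refine ⟨fun x y => ⟨fun hxy => ?_, H.color_map_iff hh⟩, fun x y hxy => le_antisymm ?_
      (H.le_dist_map hh hxy)⟩
    · simpa using H.color_map_iff (inv_mem hh) hxy
    -- The opposite inequality is the same bound for `h⁻¹`.
    · simpa using H.le_dist_map (inv_mem hh) (H.color_map_iff hh hxy)
  · rintro ⟨h1, h2⟩
    have h1' : ∀ x y, c (h⁻¹ x) = c (h⁻¹ y) ↔ c x = c y := fun x y => by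
      rw [← h1]; simp
    have h2' : ∀ x y, c x = c y → d (h⁻¹ x) (h⁻¹ y) = d x y := fun x y hxy => by
      rw [← h2 _ _ ((h1' x y).2 hxy)]; simp
    have key : ∀ k : Equiv.Perm X, (∀ x y, c (k x) = c (k y) ↔ c x = c y) →
        (∀ x y, c x = c y → d (k x) (k y) = d x y) →
        (∀ x y, c x = c y → d (k⁻¹ x) (k⁻¹ y) = d x y) → ∀ g ∈ colorIsom c d,
        k * g * k⁻¹ ∈ colorIsom c d := by
      intro k hk1 hk2 hk3 g hg
      have hk1' : ∀ x y, c (k⁻¹ x) = c (k⁻¹ y) ↔ c x = c y := fun x y => by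
        rw [← hk1]; simp
      refine ⟨fun x => ?_, fun x y hxy => ?_⟩
      · have := (hk1 _ _).2 (hg.1 (k⁻¹ x))
        simpa using this
      · have h3 := (hk1' x y).2 hxy
        simp only [Equiv.Perm.mul_apply]
        rw [hk2 _ _ (by rw [hg.1, hg.1, h3]), hg.2 _ _ h3, hk3 _ _ hxy]
    refine Subgroup.mem_normalizer_iff.2 fun g => ⟨key h h1 h2 h2' g, fun hg => ?_⟩
    have := key h⁻¹ h1' h2' (by simpa using h2) _ hg
    simpa [mul_assoc] using this

end IsHomogeneous

end ColorIsom

/-! ### The ultrametric on finite sets given by the maximum of the symmetric difference -/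

section SymmDiffMax

variable {O : Type u} [LinearOrder O]

theorem max_symmDiff_le (s t : Finset O) : (symmDiff s t).max ≤ max s.max t.max := by
  refine Finset.max_le fun a ha => ?_
  rcases Finset.mem_symmDiff.1 ha with h | h
  · exact le_max_of_le_left (Finset.le_max h.1)
  · exact le_max_of_le_right (Finset.le_max h.1)

theorem max_symmDiff_of_lt {s t : Finset O} (h : s.max < t.max) :
    (symmDiff s t).max = t.max := by
  refine le_antisymm ((max_symmDiff_le s t).trans (max_eq_right h.le).le) ?_
  obtain ⟨a, ha⟩ := WithBot.ne_bot_iff_exists.1 (ne_bot_of_gt h)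
  rw [← ha] at h ⊢
  refine Finset.le_max (Finset.mem_symmDiff.2 (Or.inr ⟨Finset.mem_of_max ha.symm, fun hs => ?_⟩))
  exact absurd (Finset.le_max hs) (not_le.2 h)

theorem max_symmDiff_of_gt {s t : Finset O} (h : t.max < s.max) :
    (symmDiff s t).max = s.max := by
  rw [symmDiff_comm, max_symmDiff_of_lt h]

/-- A common maximum cancels in the symmetric difference. -/
theorem max_symmDiff_lt {s t : Finset O} (h : s.max = t.max) (hs : s.max ≠ ⊥) :
    (symmDiff s t).max < s.max := by
  refine lt_of_le_of_ne ((max_symmDiff_le s t).trans (by rw [← h, max_self])) fun he => ?_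
  obtain ⟨a, ha⟩ := WithBot.ne_bot_iff_exists.1 hs
  have h1 := Finset.mem_of_max ha.symm
  have h2 := Finset.mem_of_max (ha.trans h).symm
  have h3 := Finset.mem_of_max (ha.trans he.symm).symm
  rcases Finset.mem_symmDiff.1 h3 with h | h
  · exact h.2 h2
  · exact h.2 h1

theorem max_symmDiff_eq_bot {s t : Finset O} : (symmDiff s t).max = ⊥ ↔ s = t := by
  rw [Finset.max_eq_bot, ← Finset.bot_eq_empty, symmDiff_eq_bot]

theorem symmDiff_symmDiff_symmDiff (s t r : Finset O) :
    symmDiff (symmDiff s t) (symmDiff t r) = symmDiff s r := by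
  rw [symmDiff_assoc, symmDiff_symmDiff_cancel_left]

theorem max_symmDiff_triangle (s t r : Finset O) :
    (symmDiff s r).max ≤ max (symmDiff s t).max (symmDiff t r).max := by
  rw [← symmDiff_symmDiff_symmDiff s t r]
  exact max_symmDiff_le _ _

/-- No three finite sets are equidistant at a positive distance. -/
theorem max_symmDiff_lt_of_eq {s t r : Finset O} (h : (symmDiff s t).max = (symmDiff t r).max)
    (hst : s ≠ t) : (symmDiff s r).max < (symmDiff s t).max := by
  rw [← symmDiff_symmDiff_symmDiff s t r]
  exact max_symmDiff_lt h (mt max_symmDiff_eq_bot.1 hst)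

end SymmDiffMax

/-! ### Forgetting maxima below a bound -/

section Cut

/-- `cut γ m` is `m` if `m ≥ γ`, and `⊥` otherwise. -/
noncomputable def cut (γ : Ordinal.{u}) (m : WithBot Ordinal.{u}) : WithBot Ordinal.{u} :=
  if (γ : WithBot Ordinal.{u}) ≤ m then m else ⊥

variable {γ δ : Ordinal.{u}} {m : WithBot Ordinal.{u}}

theorem cut_of_le (h : (γ : WithBot Ordinal.{u}) ≤ m) : cut γ m = m := if_pos h

theorem cut_of_lt (h : m < (γ : WithBot Ordinal.{u})) : cut γ m = ⊥ := if_neg (not_le.2 h)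

theorem cut_eq_bot : cut γ m = ⊥ ↔ m < (γ : WithBot Ordinal.{u}) := by
  rcases lt_or_ge m γ with h | h
  · simp [cut_of_lt h, h]
  · simp only [cut_of_le h, not_lt.2 h, iff_false]
    rintro rfl
    simp at h

theorem cut_cases (γ : Ordinal.{u}) (m : WithBot Ordinal.{u}) :
    (m < γ ∧ cut γ m = ⊥) ∨ ((γ : WithBot Ordinal.{u}) ≤ m ∧ cut γ m = m) := by
  rcases lt_or_ge m γ with h | h
  · exact Or.inl ⟨h, cut_of_lt h⟩
  · exact Or.inr ⟨h, cut_of_le h⟩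

theorem cut_eq_cut {m' : WithBot Ordinal.{u}} :
    cut γ m = cut γ m' ↔ (m < γ ∧ m' < γ) ∨ ((γ : WithBot Ordinal.{u}) ≤ m ∧ m = m') := by
  rcases cut_cases γ m with ⟨h, e⟩ | ⟨h, e⟩
  · rw [e, eq_comm, cut_eq_bot]
    simp [h, not_le.2 h]
  · simp only [not_lt.2 h, h, false_and, true_and, false_or, e]
    rcases cut_cases γ m' with ⟨h', e'⟩ | ⟨h', e'⟩
    · rw [e']
      have := h'.trans_le h
      exact ⟨fun h0 => absurd this (by simp [h0]), fun h0 => absurd this (by simp [h0])⟩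
    · rw [e']

theorem cut_cut (h : γ ≤ δ) : cut δ (cut γ m) = cut δ m := by
  have h' : (γ : WithBot Ordinal.{u}) ≤ δ := WithBot.coe_le_coe.2 h
  rcases cut_cases γ m with ⟨h1, e⟩ | ⟨h1, e⟩
  · rw [e, cut_of_lt (h1.trans_le h'), cut_of_lt (WithBot.bot_lt_coe _)]
  · rw [e]

/-- The value `max γ (cut γ m)` confuses `m < γ` with `m = γ` and nothing else, which is exactly
what `cut (γ + 1)` identifies. This turns an invariant of stage `γ` into the colour of stage `γ +
1`. -/
theorem cut_add_one_max_cut : cut (γ + 1) (max γ (cut γ m)) = cut (γ + 1) m := by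
  have h' : (γ : WithBot Ordinal.{u}) < (γ + 1 : Ordinal.{u}) :=
    WithBot.coe_lt_coe.2 (Order.lt_add_one_iff.2 le_rfl)
  rcases cut_cases γ m with ⟨h1, e⟩ | ⟨h1, e⟩
  · rw [e, max_eq_left bot_le, cut_of_lt h', cut_of_lt (h1.trans h')]
  · rw [e, max_eq_right h1]

/-- Changing a finite set below the bound `max γ (cut γ r.max)` preserves `cut γ r.max`. -/
theorem cut_max_symmDiff {r t : Finset Ordinal.{u}} (ht : t.max < max (γ : WithBot Ordinal.{u})
    (cut γ r.max)) :
    cut γ (symmDiff r t).max = cut γ r.max := by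
  rcases cut_cases γ r.max with ⟨h1, e⟩ | ⟨h1, e⟩
  · rw [e, max_eq_left bot_le] at ht
    rw [e, cut_eq_bot]
    exact (max_symmDiff_le r t).trans_lt (max_lt h1 ht)
  · rw [e, max_eq_right h1] at ht
    rw [max_symmDiff_of_gt ht]

/-- The quantity `max γ (cut γ s.max)` is the strict bound on distances inside a single-label colour
class. -/
theorem max_symmDiff_lt_of_cut_eq {s t : Finset Ordinal.{u}}
    (h : cut γ s.max = cut γ t.max) : (symmDiff s t).max < max (γ : WithBot Ordinal.{u})
        (cut γ s.max) := by
  rcases cut_eq_cut.1 h with ⟨h1, h2⟩ | ⟨h1, h2⟩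
  · exact lt_max_of_lt_left ((max_symmDiff_le s t).trans_lt (max_lt h1 h2))
  · rw [cut_of_le h1, max_eq_right h1]
    exact max_symmDiff_lt h2 (ne_bot_of_le_ne_bot (WithBot.coe_ne_bot) h1)

end Cut

/-! ### Labelled finite sets and the homogeneity of their colour classes -/

section Points

variable {ι : Type v} [DecidableEq ι] {i₀ : ι} {α β γ δ : Ordinal.{u}}

/-- The finite sets of ordinals less than `α`, together with additional copies, labelled by the
elements of `ι` other than `i₀`, of the family of those with maximum `β`. -/
structure LabelSet {ι : Type v} (i₀ : ι) (α β : Ordinal.{u}) : Type (max v (u + 1)) where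
  /-- the label -/
  label : ι
  /-- the finite set -/
  set : Finset Ordinal.{u}
  max_lt : set.max < α
  max_eq : label ≠ i₀ → set.max = β

namespace LabelSet

theorem ext' {ι : Type v} {i₀ : ι} {x y : LabelSet i₀ α β} (h1 : x.label = y.label)
    (h2 : x.set = y.set) : x = y := by
  cases x; cases y; congr

/-- The distance between labelled sets: the maximum of the symmetric difference if the labels agree,
and `β` otherwise. -/
noncomputable def dist (x y : LabelSet i₀ α β) : WithBot Ordinal.{u} :=
  if x.label = y.label then (symmDiff x.set y.set).max else β

/-- The colour of a labelled set at stage `γ`: its maximum is forgotten if it is less than `γ`, and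
its label is forgotten from stage `1` on. -/
noncomputable def color {ι : Type v} {i₀ : ι} (γ : Ordinal.{u}) (x : LabelSet i₀ α β) :
    ι × WithBot Ordinal.{u} :=
  open Classical in (if γ = 0 then x.label else i₀, cut γ x.set.max)

theorem dist_of_eq {x y : LabelSet i₀ α β} (h : x.label = y.label) :
    dist x y = (symmDiff x.set y.set).max := if_pos h

theorem dist_of_ne {x y : LabelSet i₀ α β} (h : x.label ≠ y.label) : dist x y = β := if_neg h

theorem dist_comm (x y : LabelSet i₀ α β) : dist x y = dist y x := by
  rw [dist, dist, symmDiff_comm]; simp only [eq_comm]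

theorem dist_eq_bot (x y : LabelSet i₀ α β) : dist x y = ⊥ ↔ x = y := by
  by_cases h : x.label = y.label
  · rw [dist_of_eq h, max_symmDiff_eq_bot]
    exact ⟨ext' h, fun h => h ▸ rfl⟩
  · rw [dist_of_ne h]
    exact ⟨fun h => absurd h WithBot.coe_ne_bot, fun h' => absurd (h' ▸ rfl) h⟩

theorem color_eq_iff {ι : Type v} {i₀ : ι} {x y : LabelSet i₀ α β} :
    color γ x = color γ y ↔ (γ = 0 → x.label = y.label) ∧ cut γ x.set.max = cut γ y.set.max := by
  by_cases h : γ = 0 <;> simp [color, h]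

theorem color_eq_mono {ι : Type v} {i₀ : ι} (h : γ ≤ δ) {x y : LabelSet i₀ α β} (hxy :
    color γ x = color γ y) :
    color δ x = color δ y := by
  rw [color_eq_iff] at hxy ⊢
  refine ⟨fun h0 => hxy.1 (nonpos_iff_eq_zero.1 (h.trans h0.le)), ?_⟩
  rw [← cut_cut h, hxy.2, cut_cut h]

/-- Points with different labels have maximum `β` if they have the same colour. -/
theorem max_eq_of_label_ne {ι : Type v} {i₀ : ι} (hγ : γ ≤ β ∨ Subsingleton ι) {x y :
    LabelSet i₀ α β}
    (hxy : cut γ x.set.max = cut γ y.set.max) (h : x.label ≠ y.label) :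
    x.set.max = β ∧ y.set.max = β := by
  rcases hγ with hγ | hγ
  · have hγ' : (γ : WithBot Ordinal.{u}) ≤ β := WithBot.coe_le_coe.2 hγ
    rcases cut_eq_cut.1 hxy with ⟨h1, h2⟩ | ⟨h1, h2⟩
    · have hx : x.label = i₀ := by
        by_contra hx; rw [x.max_eq hx] at h1; exact absurd h1 (not_lt.2 hγ')
      have hy : y.label = i₀ := by
        by_contra hy; rw [y.max_eq hy] at h2; exact absurd h2 (not_lt.2 hγ')
      exact absurd (hx.trans hy.symm) h
    · rw [← h2, and_self]
      by_cases hx : x.label = i₀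
      · rw [h2]; exact y.max_eq fun hy => h (hx.trans hy.symm)
      · exact x.max_eq hx
  · exact absurd (Subsingleton.elim _ _) h

theorem dist_lt_of_color_eq_of_label_eq {x y : LabelSet i₀ α β} (hxy : color γ x = color γ y)
    (h : x.label = y.label) : dist x y < max (γ : WithBot Ordinal.{u}) (cut γ x.set.max) := by
  rw [dist_of_eq h]
  exact max_symmDiff_lt_of_cut_eq (color_eq_iff.1 hxy).2

theorem label_eq_of_color_eq {ι : Type v} {i₀ : ι} (hγ : γ ≤ β ∨ Subsingleton ι) {x y :
    LabelSet i₀ α β}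
    (hxy : color γ x = color γ y) (h : γ = 0 ∨ x.set.max ≠ β) : x.label = y.label := by
  rcases h with h | h
  · exact (color_eq_iff.1 hxy).1 h
  · by_contra h'
    exact h (max_eq_of_label_ne hγ (color_eq_iff.1 hxy).2 h').1

theorem dist_le_of_color_eq (hγ : γ ≤ β ∨ Subsingleton ι) {x y : LabelSet i₀ α β}
    (hxy : color γ x = color γ y) :
    dist x y ≤ max (γ : WithBot Ordinal.{u}) (cut γ x.set.max) := by
  by_cases h : x.label = y.label
  · exact (dist_lt_of_color_eq_of_label_eq hxy h).le
  · have h1 := (max_eq_of_label_ne hγ (color_eq_iff.1 hxy).2 h)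
    rw [dist_of_ne h]
    rcases hγ with hγ | hγ
    · rw [h1.1, cut_of_le (WithBot.coe_le_coe.2 hγ)]
      exact le_max_right _ _
    · exact absurd (Subsingleton.elim _ _) h

/-- The cross distance `β` is compatible with the ultrametric because a class with several labels
consists of sets with maximum `β`, whose distances within a label cannot exceed `β`. -/
theorem dist_triangle (hγ : γ ≤ β ∨ Subsingleton ι) {x y z : LabelSet i₀ α β}
    (hxy : color γ x = color γ y) (hyz : color γ y = color γ z) :
    dist x z ≤ max (dist x y) (dist y z) := by
  by_cases h1 : x.label = y.label <;> by_cases h2 : y.label = z.label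
  · rw [dist_of_eq h1, dist_of_eq h2, dist_of_eq (h1.trans h2)]
    exact max_symmDiff_triangle _ _ _
  · rw [dist_of_ne h2, dist_of_ne (h1 ▸ h2)]
    exact le_max_right _ _
  · rw [dist_of_ne h1, dist_of_ne (h2 ▸ h1)]
    exact le_max_left _ _
  · rw [dist_of_ne h1]
    refine le_max_of_le_left ?_
    by_cases h3 : x.label = z.label
    · have hx := (max_eq_of_label_ne hγ (color_eq_iff.1 hxy).2 h1).1
      have hz := (max_eq_of_label_ne hγ (color_eq_iff.1 hyz).2 h2).2
      rw [dist_of_eq h3]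
      refine (max_symmDiff_le _ _).trans ?_
      rw [hx, hz, max_self]
    · rw [dist_of_ne h3]

/-- Every ordinal below the bound on the distances in a colour class is such a distance. -/
theorem exists_dist_eq (hγ : γ ≤ β ∨ Subsingleton ι) (hγα : γ ≤ α) (x : LabelSet i₀ α β)
    {e : WithBot Ordinal.{u}} (he : e < max (γ : WithBot Ordinal.{u}) (cut γ x.set.max)) :
    ∃ z, color γ z = color γ x ∧ z.label = x.label ∧ dist x z = e := by
  induction e with
  | bot => exact ⟨x, rfl, rfl, (dist_eq_bot _ _).2 rfl⟩
  | coe a =>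
    -- The witness toggles the single ordinal `a` in `x.set`. This moves `x` by exactly `a`, and
    -- since `a` is below the bound the colour is unchanged.
    have ha : ({a} : Finset Ordinal.{u}).max = a := Finset.max_singleton
    have hcut := cut_max_symmDiff (r := x.set) (t := {a}) (by rwa [ha])
    have hlt : (a : WithBot Ordinal.{u}) < α := by
      refine he.trans_le (max_le (WithBot.coe_le_coe.2 hγα) ?_)
      rcases cut_cases γ x.set.max with ⟨-, h⟩ | ⟨-, h⟩ <;> rw [h]
      · exact bot_le
      · exact x.max_lt.le
    refine ⟨⟨x.label, symmDiff x.set {a}, (max_symmDiff_le _ _).trans_lt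
      (_root_.max_lt x.max_lt (by rwa [ha])), fun hi => ?_⟩, ?_, rfl, ?_⟩
    · have hx := x.max_eq hi
      rcases hγ with hγ | hγ
      · have hγ' : (γ : WithBot Ordinal.{u}) ≤ β := WithBot.coe_le_coe.2 hγ
        rw [hx, cut_of_le hγ'] at hcut
        rcases cut_cases γ (symmDiff x.set {a}).max with ⟨-, h⟩ | ⟨-, h⟩
        · rw [h] at hcut; exact absurd hcut.symm WithBot.coe_ne_bot
        · exact h.symm.trans hcut
      · exact absurd (Subsingleton.elim _ _) hi
    · exact color_eq_iff.2 ⟨fun _ => rfl, hcut⟩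
    · rw [dist_of_eq (by rfl)]
      show (symmDiff x.set (symmDiff x.set {a})).max = a
      rw [symmDiff_symmDiff_cancel_left, ha]

/-- An involution preserving the colours and the distances inside each colour on a part of the
points, and extended by the identity, is in the group of stage `γ`. -/
theorem exists_mem_colorIsom_of_involution (U : LabelSet i₀ α β → Prop)
    (F : LabelSet i₀ α β → LabelSet i₀ α β) (hU : ∀ x, U x → U (F x))
    (hF : ∀ x, U x → F (F x) = x) (hc : ∀ x, U x → color γ (F x) = color γ x)
    (hd : ∀ x y, U x → U y → dist (F x) (F y) = dist x y)
    (hd' : ∀ x y, U x → ¬ U y → color γ x = color γ y → dist (F x) y = dist x y) :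
    ∃ g ∈ colorIsom (color γ) (dist (i₀ := i₀) (α := α) (β := β)),
      (∀ x, U x → g x = F x) ∧ ∀ x, ¬ U x → g x = x := by
  classical
  have hinv : Function.Involutive fun x => if U x then F x else x := by
    intro x
    by_cases h : U x <;> simp [h, hU, hF]
  refine ⟨hinv.toPerm, ⟨fun x => ?_, fun x y hxy => ?_⟩, fun x hx => if_pos hx,
    fun x hx => if_neg hx⟩
  · by_cases h : U x <;> simp [h, hc]
  · by_cases h : U x <;> by_cases h' : U y <;> simp only [Function.Involutive.coe_toPerm, h, h',
      if_true, if_false]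
    · exact hd x y h h'
    · exact hd' x y h h' hxy
    · rw [dist_comm x, dist_comm x]
      exact hd' y x h' h hxy.symm

/-- Translation by `y.set ∆ y'.set` is an isometry taking `y` to `y'`. It is applied only on the
ball around `y` whose radius is the distance from `y` to `y'`. A point equidistant from both is
outside that ball, since finite sets contain no equilateral triangle. -/
theorem exists_swap_of_label_eq (hγ : γ ≤ β ∨ Subsingleton ι) {y y' : LabelSet i₀ α β}
    (hy : color γ y = color γ y') (hl : y.label = y'.label) :
    ∃ g ∈ colorIsom (color γ) (dist (i₀ := i₀) (α := α) (β := β)), g y = y' ∧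
      ∀ x, color γ x = color γ y → dist x y = dist x y' → x ≠ y → g x = x := by
  have hcut := (color_eq_iff.1 hy).2
  have htlt := max_symmDiff_lt_of_cut_eq hcut
  set t := symmDiff y.set y'.set with ht
  have key : ∀ x : LabelSet i₀ α β, cut γ x.set.max = cut γ y.set.max →
      cut γ (symmDiff x.set t).max = cut γ x.set.max := fun x hx =>
    cut_max_symmDiff (by rwa [hx])
  have htα : t.max < α := (max_symmDiff_le _ _).trans_lt (_root_.max_lt y.max_lt y'.max_lt)
  let G : ∀ x : LabelSet i₀ α β, cut γ x.set.max = cut γ y.set.max → LabelSet i₀ α β :=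
    fun x hx => ⟨x.label, symmDiff x.set t, (max_symmDiff_le _ _).trans_lt
        (_root_.max_lt x.max_lt htα), by
      intro hi
      have h1 := key x hx
      have h2 := x.max_eq hi
      rcases hγ with hγ | hγ
      · have hγ' : (γ : WithBot Ordinal.{u}) ≤ β := WithBot.coe_le_coe.2 hγ
        rw [h2, cut_of_le hγ'] at h1
        rcases cut_cases γ (symmDiff x.set t).max with ⟨-, h⟩ | ⟨-, h⟩
        · rw [h] at h1; exact absurd h1.symm WithBot.coe_ne_bot
        · exact h.symm.trans h1
      · exact absurd (Subsingleton.elim _ _) hi⟩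
  classical
  let F : LabelSet i₀ α β → LabelSet i₀ α β := fun x =>
    if hx : cut γ x.set.max = cut γ y.set.max then G x hx else x
  have hF1 : ∀ x, (F x).label = x.label := fun x => by
    by_cases h : cut γ x.set.max = cut γ y.set.max <;> simp [F, h, G]
  have hF2 : ∀ x, cut γ x.set.max = cut γ y.set.max → (F x).set = symmDiff x.set t :=
    fun x h => by simp [F, h, G]
  refine Exists.elim (exists_mem_colorIsom_of_involution (γ := γ)
    (fun x => x.label = y.label ∧ cut γ x.set.max = cut γ y.set.max ∧
      (symmDiff x.set y.set).max ≤ t.max) F ?_ ?_ ?_ ?_ ?_) fun g ⟨hg, hg1, hg2⟩ => ?_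
  · rintro x ⟨h1, h2, h3⟩
    refine ⟨(hF1 x).trans h1, ?_, ?_⟩
    · rw [hF2 x h2, key x h2, h2]
    · rw [hF2 x h2, symmDiff_right_comm]
      exact (max_symmDiff_le _ _).trans (max_le h3 le_rfl)
  · rintro x ⟨h1, h2, h3⟩
    refine ext' (by rw [hF1, hF1]) ?_
    rw [hF2 _ (by rw [hF2 x h2, key x h2, h2]), hF2 x h2, symmDiff_symmDiff_cancel_right]
  · rintro x ⟨h1, h2, h3⟩
    exact color_eq_iff.2 ⟨fun _ => hF1 x, by rw [hF2 x h2, key x h2]⟩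
  · rintro x z ⟨h1, h2, h3⟩ ⟨h1', h2', h3'⟩
    rw [dist_of_eq (by rw [hF1, hF1, h1, h1']), dist_of_eq (h1.trans h1'.symm), hF2 x h2, hF2 z h2',
      symmDiff_comm z.set t, symmDiff_symmDiff_symmDiff]
  · rintro x z ⟨h1, h2, h3⟩ hz hxz
    by_cases hl : x.label = z.label
    · have hz2 : cut γ z.set.max = cut γ y.set.max := (color_eq_iff.1 hxz).2.symm.trans h2
      -- A point outside the ball is farther from `y` than every point of the ball, so its distance
      -- to each of them is its distance to `y`, before and after the translation.
      have hz3 : t.max < (symmDiff y.set z.set).max := by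
        rw [symmDiff_comm]
        exact not_le.1 fun h => hz ⟨hl.symm.trans h1, hz2, h⟩
      rw [dist_of_eq ((hF1 x).trans hl), dist_of_eq hl, hF2 x h2,
        ← symmDiff_symmDiff_symmDiff x.set y.set z.set, max_symmDiff_of_lt (h3.trans_lt hz3),
        ← symmDiff_symmDiff_symmDiff _ y.set z.set, max_symmDiff_of_lt]
      rw [symmDiff_right_comm]
      exact (max_symmDiff_le _ _).trans_lt (_root_.max_lt (h3.trans_lt hz3) hz3)
    · rw [dist_of_ne hl, dist_of_ne ((hF1 x).trans_ne hl)]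
  · refine ⟨g, hg, ?_, fun x hxy hd hne => hg2 x ?_⟩
    · rw [hg1 y ⟨rfl, rfl, by simp⟩]
      refine ext' ((hF1 y).trans hl) ?_
      rw [hF2 y rfl, ht, symmDiff_symmDiff_cancel_left]
    · rintro ⟨h1, -, h3⟩
      rw [dist_of_eq h1, dist_of_eq (h1.trans hl)] at hd
      refine absurd h3 (not_le.2 ?_)
      have hne' : y.set ≠ x.set := fun h => hne (ext' h1 h.symm)
      rw [symmDiff_comm] at hd
      have := max_symmDiff_lt_of_eq hd hne'
      rwa [symmDiff_comm y.set x.set] at this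

/-- Here both sets have maximum `β`. The map exchanges the two labels and translates by `y.set ∆
y'.set`, acting only on the sets of maximum `β` carrying one of these labels. -/
theorem exists_swap_of_label_ne (hγ : γ ≤ β ∨ Subsingleton ι) {y y' : LabelSet i₀ α β}
    (hy : color γ y = color γ y') (hl : y.label ≠ y'.label) :
    ∃ g ∈ colorIsom (color γ) (dist (i₀ := i₀) (α := α) (β := β)), g y = y' ∧
      ∀ x, color γ x = color γ y → dist x y = dist x y' → x ≠ y → g x = x := by
  have hcut := (color_eq_iff.1 hy).2
  have hγ0 : γ ≠ 0 := fun h => hl ((color_eq_iff.1 hy).1 h)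
  have hmax := max_eq_of_label_ne hγ hcut hl
  have htlt : (symmDiff y.set y'.set).max < β := by
    rw [← hmax.1]
    exact max_symmDiff_lt (hmax.1.trans hmax.2.symm) (by rw [hmax.1]; exact WithBot.coe_ne_bot)
  set t := symmDiff y.set y'.set with ht
  have key : ∀ x : LabelSet i₀ α β, x.set.max = β → (symmDiff x.set t).max = β := fun x hx => by
    rw [max_symmDiff_of_gt (by rwa [hx]), hx]
  have htα : t.max < α := (max_symmDiff_le _ _).trans_lt (_root_.max_lt y.max_lt y'.max_lt)
  let G : ∀ x : LabelSet i₀ α β, x.set.max = β → LabelSet i₀ α β :=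
    fun x hx => ⟨Equiv.swap y.label y'.label x.label, symmDiff x.set t,
      (max_symmDiff_le _ _).trans_lt (_root_.max_lt x.max_lt htα), fun _ => key x hx⟩
  classical
  let F : LabelSet i₀ α β → LabelSet i₀ α β := fun x =>
    if hx : x.set.max = β then G x hx else x
  have hF1 : ∀ x : LabelSet i₀ α β, x.set.max = β →
      (F x).label = Equiv.swap y.label y'.label x.label := fun x h => by
    simp [F, h, G]
  have hF2 : ∀ x : LabelSet i₀ α β, x.set.max = β → (F x).set = symmDiff x.set t :=
    fun x h => by simp [F, h, G]
  refine Exists.elim (exists_mem_colorIsom_of_involution (γ := γ)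
    (fun x =>
        (x.label = y.label ∨ x.label = y'.label) ∧ x.set.max = β) F ?_ ?_ ?_ ?_ ?_) fun g ⟨hg, hg1, hg2⟩ => ?_
  · rintro x ⟨h1, h2⟩
    refine ⟨?_, by rw [hF2 x h2, key x h2]⟩
    rw [hF1 x h2]
    rcases h1 with h1 | h1 <;> simp [h1]
  · rintro x ⟨h1, h2⟩
    have h3 : (F x).set.max = β := by rw [hF2 x h2, key x h2]
    refine ext' (by rw [hF1 _ h3, hF1 _ h2, Equiv.swap_apply_self]) ?_
    rw [hF2 _ h3, hF2 x h2, symmDiff_symmDiff_cancel_right]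
  · rintro x ⟨h1, h2⟩
    exact color_eq_iff.2 ⟨fun h => absurd h hγ0, by rw [hF2 x h2, key x h2, h2]⟩
  · rintro x z ⟨h1, h2⟩ ⟨h1', h2'⟩
    by_cases hxz : x.label = z.label
    · rw [dist_of_eq hxz, dist_of_eq (by rw [hF1 x h2, hF1 z h2', hxz]), hF2 x h2, hF2 z h2',
        symmDiff_comm z.set t, symmDiff_symmDiff_symmDiff]
    · rw [dist_of_ne hxz, dist_of_ne]
      rw [hF1 x h2, hF1 z h2']
      exact fun h => hxz (Equiv.injective _ h)
  · rintro x z ⟨h1, h2⟩ hz hxz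
    -- A point of the same colour outside the moved part has a third label, hence distance `β` to
    -- all moved points.
    have hne : ∀ w : LabelSet i₀ α β, (w.label = y.label ∨ w.label = y'.label) → w.set.max = β →
        color γ w = color γ z → w.label ≠ z.label := by
      intro w hw hw' hwz h
      refine hz ⟨h ▸ hw, ?_⟩
      rcases cut_eq_cut.1 (color_eq_iff.1 hwz).2 with ⟨h3, -⟩ | ⟨-, h3⟩
      · rcases hγ with hγ | hγ
        · rw [hw'] at h3
          exact absurd h3 (not_lt.2 (WithBot.coe_le_coe.2 hγ))
        · exact absurd (Subsingleton.elim _ _) hl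
      · exact h3.symm.trans hw'
    have h3 : (F x).set.max = β := by rw [hF2 x h2, key x h2]
    rw [dist_of_ne (hne x h1 h2 hxz), dist_of_ne (hne (F x) ?_ h3 ?_)]
    · rw [hF1 x h2]
      rcases h1 with h1 | h1 <;> simp [h1]
    · refine Eq.trans (color_eq_iff.2 ⟨fun h => absurd h hγ0, ?_⟩) hxz
      rw [h3, h2]
  · refine ⟨g, hg, ?_, fun x hxy hd hne => hg2 x ?_⟩
    · rw [hg1 y ⟨Or.inl rfl, hmax.1⟩]
      refine ext' ?_ ?_
      · rw [hF1 y hmax.1, Equiv.swap_apply_left]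
      · rw [hF2 y hmax.1, ht, symmDiff_symmDiff_cancel_left]
    -- Within one label the sets of maximum `β` are closer than `β`, so a moved point has distance
    -- `β` to exactly one of `y` and `y'` and is not equidistant from them.
    · have hlt : ∀ z : LabelSet i₀ α β, z.set.max = β → ∀ x : LabelSet i₀ α β, x.set.max = β →
          x.label = z.label → dist x z ≠ β := fun z hz x hx h => by
        rw [dist_of_eq h]
        have := max_symmDiff_lt (hx.trans hz.symm) (by rw [hx]; exact WithBot.coe_ne_bot)
        rw [hx] at this
        exact this.ne
      rintro ⟨h1 | h1, h3⟩
      · exact hlt y hmax.1 x h3 h1 (hd.trans (dist_of_ne (h1.trans_ne hl)))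
      · exact hlt y' hmax.2 x h3 h1 (hd.symm.trans (dist_of_ne (h1.trans_ne hl.symm)))

theorem isHomogeneous (hγ : γ ≤ β ∨ Subsingleton ι) (hγα : γ ≤ α) :
    IsHomogeneous (color γ) (dist (i₀ := i₀) (α := α) (β := β)) where
  eq_bot := dist_eq_bot
  symm := dist_comm
  ultra _ _ _ := dist_triangle hγ
  swap y y' h := by
    by_cases hl : y.label = y'.label
    · exact exists_swap_of_label_eq hγ h hl
    · exact exists_swap_of_label_ne hγ h hl
  sat x y e hxy he := by
    obtain ⟨z, hz, -, hd⟩ := exists_dist_eq hγ hγα x (he.trans_le (dist_le_of_color_eq hγ hxy))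
    exact ⟨z, hz, hd⟩

end LabelSet

end Points

/-! ### The stages form a normaliser tower -/

namespace LabelSet

variable {ι : Type v} [DecidableEq ι] {i₀ : ι} {α β γ δ : Ordinal.{u}}

/-- `h` permutes the colours of stage `γ` and preserves the distances inside each of them. -/
def PermutesColors (γ : Ordinal.{u}) (h : Equiv.Perm (LabelSet i₀ α β)) : Prop :=
  (∀ x y, color γ (h x) = color γ (h y) ↔ color γ x = color γ y) ∧
    ∀ x y, color γ x = color γ y → dist (h x) (h y) = dist x y

theorem PermutesColors.inv {h : Equiv.Perm (LabelSet i₀ α β)} (hh : PermutesColors γ h) :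
    PermutesColors γ h⁻¹ := by
  have h1 : ∀ x y, color γ (h⁻¹ x) = color γ (h⁻¹ y) ↔ color γ x = color γ y := fun x y => by
    rw [← hh.1]; simp
  exact ⟨h1, fun x y hxy => by rw [← hh.2 _ _ ((h1 x y).2 hxy)]; simp⟩

/-- The point `x` belongs to an equilateral triangle inside its colour class. -/
def InTriangle (γ : Ordinal.{u}) (x : LabelSet i₀ α β) : Prop :=
  ∃ y z, color γ y = color γ x ∧ color γ z = color γ x ∧ x ≠ y ∧ dist x y = dist y z ∧
    dist x z = dist x y

theorem PermutesColors.inTriangle_map {h : Equiv.Perm (LabelSet i₀ α β)} (hh : PermutesColors γ h)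
    {x : LabelSet i₀ α β} (hx : InTriangle γ x) : InTriangle γ (h x) := by
  obtain ⟨y, z, h1, h2, h3, h4, h5⟩ := hx
  refine ⟨h y, h z, (hh.1 _ _).2 h1, (hh.1 _ _).2 h2, fun he => h3 (h.injective he), ?_, ?_⟩
  · rw [hh.2 _ _ h1.symm, hh.2 _ _ (h1.trans h2.symm), h4]
  · rw [hh.2 _ _ h1.symm, hh.2 _ _ h2.symm, h5]

theorem PermutesColors.inTriangle_iff {h : Equiv.Perm (LabelSet i₀ α β)}
    (hh : PermutesColors γ h) {x : LabelSet i₀ α β} : InTriangle γ (h x) ↔ InTriangle γ x :=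
  ⟨fun hx => by simpa using hh.inv.inTriangle_map hx, hh.inTriangle_map⟩

/-- Under `hx` the colour class of `x` has a single label, and finite sets contain no equilateral
triangle of positive side. -/
theorem not_inTriangle (hγ : γ ≤ β ∨ Subsingleton ι) {x : LabelSet i₀ α β}
    (hx : γ = 0 ∨ x.set.max ≠ β ∨ Subsingleton ι) : ¬ InTriangle γ x := by
  rintro ⟨y, z, h1, h2, h3, h4, h5⟩
  have key : ∀ w : LabelSet i₀ α β, color γ w = color γ x → x.label = w.label := fun w hw => by
    rcases hx with hx | hx | hx
    · exact label_eq_of_color_eq hγ hw.symm (Or.inl hx)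
    · exact label_eq_of_color_eq hγ hw.symm (Or.inr hx)
    · exact Subsingleton.elim _ _
  have hy := key y h1
  have hz := key z h2
  rw [dist_of_eq hy, dist_of_eq (hy.symm.trans hz)] at h4
  rw [dist_of_eq hy, dist_of_eq hz] at h5
  exact (max_symmDiff_lt_of_eq h4 fun h => h3 (ext' hy h)).ne h5

/-- The same finite set with three different labels is an equilateral triangle of side `β`; the
labels share a colour once `γ ≠ 0`. -/
theorem inTriangle (hι : ∀ i : ι, ∃ j k, i ≠ j ∧ j ≠ k ∧ i ≠ k) (hγ0 : γ ≠ 0)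
    {x : LabelSet i₀ α β} (hx : x.set.max = β) : InTriangle γ x := by
  obtain ⟨j, k, hij, hjk, hik⟩ := hι x.label
  refine ⟨⟨j, x.set, x.max_lt, fun _ => hx⟩, ⟨k, x.set, x.max_lt, fun _ => hx⟩,
    color_eq_iff.2 ⟨fun h => absurd h hγ0, rfl⟩, color_eq_iff.2 ⟨fun h => absurd h hγ0, rfl⟩,
    fun h => hij (congrArg label h), ?_, ?_⟩
  · exact (dist_of_ne (by exact hij)).trans (dist_of_ne (by exact hjk)).symm
  · exact (dist_of_ne (by exact hik)).trans (dist_of_ne (by exact hij)).symm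

/-- The bound on the distances in a colour class with all labels equal is an invariant. -/
theorem PermutesColors.bound_le {h : Equiv.Perm (LabelSet i₀ α β)} (hh : PermutesColors γ h)
    (hγ : γ ≤ β ∨ Subsingleton ι) (hγα : γ ≤ α) {x : LabelSet i₀ α β}
    (hx : γ = 0 ∨ (h x).set.max ≠ β ∨ Subsingleton ι) :
    max (γ : WithBot Ordinal.{u}) (cut γ x.set.max) ≤
      max (γ : WithBot Ordinal.{u}) (cut γ (h x).set.max) := by
  -- Every `e` below the bound is a distance from `x`. The map `h` preserves it, and the class of `h
  -- x`, having one label, attains only distances strictly below its own bound.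
  refine le_of_forall_lt fun e he => ?_
  obtain ⟨z, hz, -, hd⟩ := exists_dist_eq hγ hγα x he
  have hz' := (hh.1 _ _).2 hz.symm
  rw [← hd, ← hh.2 _ _ hz.symm]
  refine dist_lt_of_color_eq_of_label_eq hz' ?_
  rcases hx with hx | hx | hx
  · exact label_eq_of_color_eq hγ hz' (Or.inl hx)
  · exact label_eq_of_color_eq hγ hz' (Or.inr hx)
  · exact Subsingleton.elim _ _

/-- For single-label classes the attained distances determine the bound. The class with maximum `β`
also attains `β` once its labels are merged, so its distances alone would not separate it from the
class with maximum `β + 1`; equilateral triangles do. -/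
theorem PermutesColors.bound_eq {h : Equiv.Perm (LabelSet i₀ α β)} (hh : PermutesColors γ h)
    (hγ : γ ≤ β ∨ Subsingleton ι) (hγα : γ ≤ α)
    (hι : Subsingleton ι ∨ ∀ i : ι, ∃ j k, i ≠ j ∧ j ≠ k ∧ i ≠ k) (x : LabelSet i₀ α β) :
    max (γ : WithBot Ordinal.{u}) (cut γ (h x).set.max) =
      max (γ : WithBot Ordinal.{u}) (cut γ x.set.max) := by
  have main : (γ = 0 ∨ (h x).set.max ≠ β ∨ Subsingleton ι) →
      (γ = 0 ∨ x.set.max ≠ β ∨ Subsingleton ι) →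
      max (γ : WithBot Ordinal.{u}) (cut γ (h x).set.max) =
      max (γ : WithBot Ordinal.{u}) (cut γ x.set.max) := fun h1 h2 => by
    refine le_antisymm ?_ (hh.bound_le hγ hγα h1)
    simpa using hh.inv.bound_le hγ hγα (x := h x) (by simpa using h2)
  by_cases hγ0 : γ = 0
  · exact main (Or.inl hγ0) (Or.inl hγ0)
  rcases hι with hι | hι
  · exact main (Or.inr (Or.inr hι)) (Or.inr (Or.inr hι))
  by_cases hx : x.set.max = β
  · have h1 := hh.inTriangle_map (inTriangle hι hγ0 hx)
    have h2 : (h x).set.max = β := by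
      by_contra h2
      exact not_inTriangle hγ (Or.inr (Or.inl h2)) h1
    rw [hx, h2]
  · by_cases hx' : (h x).set.max = β
    · exact absurd (hh.inTriangle_iff.1 (inTriangle hι hγ0 hx'))
        (not_inTriangle hγ (Or.inr (Or.inl hx)))
    · exact main (Or.inr (Or.inl hx')) (Or.inr (Or.inl hx))

theorem color_add_one {ι : Type v} {i₀ : ι} (x : LabelSet i₀ α β) :
    color (γ + 1) x = (i₀, cut (γ + 1) x.set.max) := by
  simp [color]

theorem PermutesColors.color_add_one_eq {h : Equiv.Perm (LabelSet i₀ α β)}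
    (hh : PermutesColors γ h) (hγ : γ ≤ β ∨ Subsingleton ι) (hγα : γ ≤ α)
    (hι : Subsingleton ι ∨ ∀ i : ι, ∃ j k, i ≠ j ∧ j ≠ k ∧ i ≠ k) (x : LabelSet i₀ α β) :
    color (γ + 1) (h x) = color (γ + 1) x := by
  rw [color_add_one, color_add_one, ← cut_add_one_max_cut, hh.bound_eq hγ hγα hι,
    cut_add_one_max_cut]

/-- The distance between points of different colours that get the same colour at a later stage. -/
noncomputable def colorDist (β : Ordinal.{u}) (p q : ι × WithBot Ordinal.{u}) :
    WithBot Ordinal.{u} :=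
  if p.1 = q.1 then max p.2 q.2 else β

/-- Points of different colours at stage `γ` that are merged by stage `δ` have a distance depending
only on their earlier colours. A permutation fixing the earlier colours therefore preserves it,
which makes the stages increasing. -/
theorem dist_eq_colorDist (hδ : δ ≤ β ∨ Subsingleton ι) (hγδ : γ ≤ δ) {x y : LabelSet i₀ α β}
    (h : color δ x = color δ y) (h' : color γ x ≠ color γ y) :
    dist x y = colorDist β (color γ x) (color γ y) := by
  have hγδ' : (γ : WithBot Ordinal.{u}) ≤ δ := WithBot.coe_le_coe.2 hγδ
  by_cases hl : x.label = y.label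
  · have hc : (color γ x).1 = (color γ y).1 := by by_cases h0 : γ = 0 <;> simp [color, h0, hl]
    have hcut : cut γ x.set.max ≠ cut γ y.set.max := fun hcut =>
      h' (color_eq_iff.2 ⟨fun _ => hl, hcut⟩)
    rw [dist_of_eq hl, colorDist, if_pos hc]
    show _ = max (cut γ x.set.max) (cut γ y.set.max)
    rcases cut_cases γ x.set.max with ⟨h1, e1⟩ | ⟨h1, e1⟩ <;>
    rcases cut_cases γ y.set.max with ⟨h2, e2⟩ | ⟨h2, e2⟩
    · exact absurd (e1.trans e2.symm) hcut
    · rw [e1, e2, max_eq_right bot_le, max_symmDiff_of_lt (h1.trans_le h2)]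
    · rw [e1, e2, max_eq_left bot_le, max_symmDiff_of_gt (h2.trans_le h1)]
    · rw [e1, e2] at hcut ⊢
      rcases lt_or_gt_of_ne hcut with h3 | h3
      · rw [max_symmDiff_of_lt h3, max_eq_right h3.le]
      · rw [max_symmDiff_of_gt h3, max_eq_left h3.le]
  · have hm := max_eq_of_label_ne hδ (color_eq_iff.1 h).2 hl
    have hγ0 : γ = 0 := by
      by_contra h0
      exact h' (color_eq_iff.2 ⟨fun h => absurd h h0, by rw [hm.1, hm.2]⟩)
    have hc : (color γ x).1 ≠ (color γ y).1 := by simpa [color, hγ0] using hl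
    rw [dist_of_ne hl, colorDist, if_neg hc]

variable (i₀ α β) in
/-- The group of stage `γ`. -/
noncomputable def stage (γ : Ordinal.{u}) : Subgroup (Equiv.Perm (LabelSet i₀ α β)) :=
  colorIsom (color γ) dist

theorem stage_mono (hδ : δ ≤ β ∨ Subsingleton ι) (hγδ : γ ≤ δ) :
    stage i₀ α β γ ≤ stage i₀ α β δ := by
  rintro g ⟨hg1, hg2⟩
  have key : ∀ x, color δ (g x) = color δ x := fun x => color_eq_mono hγδ (hg1 x)
  refine ⟨key, fun x y hxy => ?_⟩
  by_cases h : color γ x = color γ y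
  · exact hg2 x y h
  · rw [dist_eq_colorDist hδ hγδ hxy h, dist_eq_colorDist hδ hγδ (by rw [key, key, hxy])
      (by rwa [hg1, hg1]), hg1, hg1]

theorem mem_normalizer_stage (hγ : γ ≤ β ∨ Subsingleton ι) (hγα : γ ≤ α)
    {h : Equiv.Perm (LabelSet i₀ α β)} :
    h ∈ Subgroup.normalizer (stage i₀ α β γ : Set (Equiv.Perm (LabelSet i₀ α β))) ↔
      PermutesColors γ h :=
  (isHomogeneous hγ hγα).mem_normalizer_iff

/-- The distance between two points whose colour becomes equal exactly at stage `γ + 1`. -/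
noncomputable def mergeDist (γ : Ordinal.{u}) (m : WithBot Ordinal.{u}) : WithBot Ordinal.{u} :=
  open Classical in if m = ⊥ then γ else m

/-- Passing to stage `γ + 1` merges maximum below `γ` with maximum `γ`, at mutual distance `γ`, and,
if `γ = 0`, also the labels of the sets of maximum `β`, at mutual distance `β`. In both cases
distances inside the old classes are smaller than the mutual distance, so the distance tells whether
two points had the same old colour. The last alternative covers classes in which nothing is merged.
-/
theorem merge_iff (hγ : γ < β ∨ Subsingleton ι) {x y : LabelSet i₀ α β}
    (h : color (γ + 1) x = color (γ + 1) y) :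
    (color γ x ≠ color γ y → dist x y = mergeDist γ (color (γ + 1) x).2) ∧
    (color γ x = color γ y ↔ dist x y < mergeDist γ (color (γ + 1) x).2 ∨
      (γ ≠ 0 ∧ (color (γ + 1) x).2 ≠ ⊥)) := by
  have hsucc : ∀ {m : WithBot Ordinal.{u}}, m < (γ + 1 : Ordinal.{u}) ↔ m ≤ γ := by
    intro m
    induction m with
    | bot => simp
    | coe m => rw [WithBot.coe_lt_coe, WithBot.coe_le_coe, Order.lt_add_one_iff]
  have hγ1 : γ + 1 ≤ β ∨ Subsingleton ι := hγ.imp_left Order.add_one_le_of_lt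
  have hcut : cut (γ + 1) x.set.max = cut (γ + 1) y.set.max := (color_eq_iff.1 h).2
  have hcx : (color (γ + 1) x).2 = cut (γ + 1) x.set.max := rfl
  rw [hcx]
  rcases cut_eq_cut.1 hcut with ⟨h1, h2⟩ | ⟨h1, h2⟩
  · rw [cut_of_lt h1, mergeDist, if_pos rfl]
    have hl : x.label = y.label := by
      by_contra hl
      have := (max_eq_of_label_ne hγ1 hcut hl).1
      rcases hγ with hγ | hγ
      · rw [this, hsucc, WithBot.coe_le_coe] at h1
        exact absurd h1 (not_le.2 hγ)
      · exact hl (Subsingleton.elim _ _)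
    rw [hsucc] at h1 h2
    have A : color γ x ≠ color γ y → dist x y = γ := fun hne => by
      have hcut' : cut γ x.set.max ≠ cut γ y.set.max := fun hc =>
        hne (color_eq_iff.2 ⟨fun _ => hl, hc⟩)
      rw [dist_of_eq hl]
      rcases cut_cases γ x.set.max with ⟨h3, e1⟩ | ⟨h3, e1⟩ <;>
      rcases cut_cases γ y.set.max with ⟨h4, e2⟩ | ⟨h4, e2⟩
      · exact absurd (e1.trans e2.symm) hcut'
      · rw [max_symmDiff_of_lt (h3.trans_le h4), le_antisymm h2 h4]
      · rw [max_symmDiff_of_gt (h4.trans_le h3), le_antisymm h1 h3]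
      · exact absurd (by rw [le_antisymm h1 h3, le_antisymm h2 h4]) hcut'
    refine ⟨A, fun he => Or.inl ?_, fun hd => ?_⟩
    · refine (dist_lt_of_color_eq_of_label_eq he hl).trans_le (max_le le_rfl ?_)
      rcases cut_cases γ x.set.max with ⟨h3, e1⟩ | ⟨h3, e1⟩ <;> rw [e1]
      exacts [bot_le, h1]
    · by_contra hne
      rcases hd with hd | hd
      · exact hd.ne (A hne)
      · exact hd.2 rfl
  · have hb : x.set.max ≠ ⊥ := ne_bot_of_le_ne_bot WithBot.coe_ne_bot h1
    rw [cut_of_le h1, mergeDist, if_neg hb]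
    by_cases h0 : γ = 0
    · have A : color γ x ≠ color γ y → dist x y = x.set.max := fun hne => by
        have hl : x.label ≠ y.label := fun hl => hne (color_eq_iff.2 ⟨fun _ => hl, by rw [h2]⟩)
        rw [dist_of_ne hl, (max_eq_of_label_ne hγ1 hcut hl).1]
      refine ⟨A, fun he => Or.inl ?_, fun hd => ?_⟩
      · have hl := (color_eq_iff.1 he).1 h0
        rw [dist_of_eq hl]
        exact max_symmDiff_lt h2 hb
      · by_contra hne
        rcases hd with hd | hd
        · exact hd.ne (A hne)
        · exact hd.1 h0
    · have he : color γ x = color γ y := color_eq_iff.2 ⟨fun h => absurd h h0, by rw [h2]⟩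
      exact ⟨fun h => absurd he h, fun _ => Or.inr ⟨h0, hb⟩, fun _ => he⟩

/-- A permutation of the old colours fixes the new ones because bounds are invariant, and it
preserves the new distances because these are functions of the new colour. Conversely, distances
inside a new colour determine the old partition. -/
theorem normalizer_stage (hγ : γ < β ∨ Subsingleton ι) (hγα : γ ≤ α)
    (hι : Subsingleton ι ∨ ∀ i : ι, ∃ j k, i ≠ j ∧ j ≠ k ∧ i ≠ k) :
    Subgroup.normalizer (stage i₀ α β γ : Set (Equiv.Perm (LabelSet i₀ α β))) =
      stage i₀ α β (γ + 1) := by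
  have hγ' : γ ≤ β ∨ Subsingleton ι := hγ.imp_left le_of_lt
  have hle : γ ≤ γ + 1 := (Order.lt_add_one_iff.2 le_rfl).le
  ext h
  rw [mem_normalizer_stage hγ' hγα]
  constructor
  · intro hh
    have key := hh.color_add_one_eq hγ' hγα hι
    refine ⟨key, fun x y hxy => ?_⟩
    by_cases hc : color γ x = color γ y
    · exact hh.2 x y hc
    · rw [(merge_iff hγ hxy).1 hc, (merge_iff hγ (by rw [key, key, hxy])).1 (by rwa [ne_eq, hh.1]),
        key]
  · rintro ⟨h1, h2⟩
    have key : ∀ x y, color γ (h x) = color γ (h y) ↔ color γ x = color γ y := by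
      intro x y
      by_cases hc : color (γ + 1) x = color (γ + 1) y
      · rw [(merge_iff hγ hc).2, (merge_iff hγ (by rw [h1, h1, hc])).2, h1, h2 _ _ hc]
      · exact ⟨fun h' => absurd (color_eq_mono hle h') (by rwa [h1, h1]),
          fun h' => absurd (color_eq_mono hle h') hc⟩
    exact ⟨key, fun x y hxy => h2 x y (color_eq_mono hle hxy)⟩

/-- If there are at least three labels, then the group of stage `β` is self-normalising. -/
theorem normalizer_stage_self (hβ : β ≠ 0) (hβα : β ≤ α)
    (hι : ∀ i : ι, ∃ j k, i ≠ j ∧ j ≠ k ∧ i ≠ k) :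
    Subgroup.normalizer (stage i₀ α β β : Set (Equiv.Perm (LabelSet i₀ α β))) =
      stage i₀ α β β := by
  refine le_antisymm (fun h hh => ?_) Subgroup.le_normalizer
  have hββ : β ≤ β ∨ Subsingleton ι := Or.inl le_rfl
  rw [mem_normalizer_stage hββ hβα] at hh
  refine ⟨fun x => color_eq_iff.2 ⟨fun h => absurd h hβ, ?_⟩, hh.2⟩
  have htri : ∀ y : LabelSet i₀ α β, InTriangle β y ↔ y.set.max = β := fun y =>
    ⟨fun hy => by_contra fun hne => not_inTriangle hββ (Or.inr (Or.inl hne)) hy, inTriangle hι hβ⟩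
  have h1 := hh.inTriangle_iff (x := x)
  rw [htri, htri] at h1
  have h2 := hh.bound_eq hββ hβα (Or.inr hι) x
  -- The classes with maximum below `β` and with maximum `β` share the bound `β`, so an exchange of
  -- these two is the only way to move a colour; the triangles exclude it.
  rcases cut_cases β x.set.max with ⟨h3, e1⟩ | ⟨h3, e1⟩ <;>
  rcases cut_cases β (h x).set.max with ⟨h4, e2⟩ | ⟨h4, e2⟩ <;> rw [e1, e2] <;> rw [e1, e2] at h2
  · rw [max_eq_left bot_le, max_eq_right h4] at h2
    exact absurd (h1.1 h2) h3.ne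
  · rw [max_eq_left bot_le, max_eq_right h3] at h2
    exact absurd (h1.2 h2.symm) h4.ne
  · rwa [max_eq_right h3, max_eq_right h4] at h2

/-- From stage `α` on, all maxima are forgotten and a single colour remains. -/
theorem stage_self_eq_of_subsingleton [Subsingleton ι] (hγ : α ≤ γ) :
    stage i₀ α β γ = stage i₀ α β α := by
  have : ∀ γ, α ≤ γ → ∀ x y : LabelSet i₀ α β, color γ x = color γ y := fun γ hγ x y => by
    have h' : (α : WithBot Ordinal.{u}) ≤ γ := WithBot.coe_le_coe.2 hγ
    refine color_eq_iff.2 ⟨fun _ => Subsingleton.elim _ _, ?_⟩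
    rw [cut_of_lt (x.max_lt.trans_le h'), cut_of_lt (y.max_lt.trans_le h')]
  ext g
  exact ⟨fun hg => ⟨fun x => this α le_rfl _ _, fun x y _ => hg.2 x y (this γ hγ x y)⟩,
    fun hg => ⟨fun x => this γ hγ _ _, fun x y _ => hg.2 x y (this α le_rfl x y)⟩⟩

/-- The maximum of a set is its distance to `∅`. Hence `g` can change only maxima below a bound that
exceeds the maximum of `g ∅`, and such a bound exists below the limit. -/
theorem exists_mem_stage_of_isSuccLimit (hδ : δ ≤ β ∨ Subsingleton ι) (hl : Order.IsSuccLimit δ)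
    {g : Equiv.Perm (LabelSet i₀ α β)} (hg : g ∈ stage i₀ α β δ) :
    ∃ γ < δ, g ∈ stage i₀ α β γ := by
  have hempty : (∅ : Finset Ordinal.{u}).max = ⊥ := rfl
  let o : LabelSet i₀ α β := ⟨i₀, ∅, by simp [hempty], fun h => absurd rfl h⟩
  have ho : cut δ o.set.max = ⊥ := cut_of_lt (WithBot.bot_lt_coe _)
  have hlabel : ∀ x : LabelSet i₀ α β, x.set.max < δ → x.label = i₀ := fun x hx => by
    rcases hδ with hδ | hδ
    · by_contra h
      rw [x.max_eq h] at hx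
      exact absurd hx (not_lt.2 (WithBot.coe_le_coe.2 hδ))
    · exact Subsingleton.elim _ _
  have hgo : (g o).set.max < δ := cut_eq_bot.1 ((color_eq_iff.1 (hg.1 o)).2.trans ho)
  -- A nonzero `γ` is needed because the colour of stage 0 still records the label.
  obtain ⟨γ, hγδ, hγ0, hγ⟩ : ∃ γ < δ, γ ≠ 0 ∧ (g o).set.max < γ := by
    generalize (g o).set.max = m at hgo
    induction m with
    | bot => exact ⟨0 + 1, hl.add_one_lt hl.bot_lt, by simp, WithBot.bot_lt_coe _⟩
    | coe a => exact ⟨a + 1, hl.add_one_lt (WithBot.coe_lt_coe.1 hgo), by simp,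
        WithBot.coe_lt_coe.2 (Order.lt_add_one_iff.2 le_rfl)⟩
  have key : ∀ x, cut γ (g x).set.max = cut γ x.set.max := by
    intro x
    have hc := (color_eq_iff.1 (hg.1 x)).2
    rcases cut_eq_cut.1 hc with ⟨h1, h2⟩ | ⟨-, h2⟩
    · have hd := hg.2 x o (color_eq_iff.2 ⟨fun h => absurd hl.bot_lt (by simp [h]), by
        rw [ho, cut_of_lt h2]⟩)
      rw [dist_of_eq ((hlabel _ h1).trans (hlabel _ hgo).symm), dist_of_eq (hlabel _ h2)] at hd
      have hd' : (symmDiff x.set o.set).max = x.set.max := by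
        show (symmDiff x.set ⊥).max = _
        rw [symmDiff_bot]
      rw [hd'] at hd
      rw [← hd]
      refine (cut_max_symmDiff (lt_max_of_lt_left hγ)).symm
    · rw [h2]
  refine ⟨γ, hγδ, fun x => color_eq_iff.2 ⟨fun h => absurd h hγ0, key x⟩, fun x y hxy =>
    hg.2 x y (color_eq_mono hγδ.le hxy)⟩

/-- The sets `∅` and `{γ}` have the same colour at stage `δ`, hence lie in one orbit there, but
their colours at stage `γ` differ. -/
theorem stage_ne (hδ : δ ≤ β ∨ Subsingleton ι) (hδα : δ ≤ α) (hγδ : γ < δ) :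
    stage i₀ α β γ ≠ stage i₀ α β δ := by
  intro he
  have hempty : (∅ : Finset Ordinal.{u}).max = ⊥ := rfl
  have hγα : (γ : WithBot Ordinal.{u}) < α := WithBot.coe_lt_coe.2 (hγδ.trans_le hδα)
  have hγδ' : (γ : WithBot Ordinal.{u}) < δ := WithBot.coe_lt_coe.2 hγδ
  let o : LabelSet i₀ α β := ⟨i₀, ∅, by simp [hempty], fun h => absurd rfl h⟩
  let p : LabelSet i₀ α β := ⟨i₀, {γ}, by simpa using hγα, fun h => absurd rfl h⟩
  have hp : p.set.max = γ := Finset.max_singleton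
  have hop : color δ o = color δ p := color_eq_iff.2 ⟨fun _ => rfl, by
    rw [hp, cut_of_lt hγδ']; exact cut_of_lt (WithBot.bot_lt_coe _)⟩
  obtain ⟨g, hg, hgo, -⟩ := (isHomogeneous hδ hδα).swap o p hop
  have hg' : g ∈ stage i₀ α β γ := he ▸ hg
  have h1 := (color_eq_iff.1 (hg'.1 o)).2
  rw [hgo, hp, cut_of_le le_rfl, cut_of_lt (show o.set.max < γ from WithBot.bot_lt_coe _)] at h1
  exact WithBot.coe_ne_bot h1

variable {A : Type u} [Group A]

theorem normTower_map_stage {τ : Ordinal.{u}} (L : Equiv.Perm (LabelSet i₀ α β) ≃* A)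
    (hτ : τ ≤ β ∨ Subsingleton ι) (hτα : τ ≤ α)
    (hι : Subsingleton ι ∨ ∀ i : ι, ∃ j k, i ≠ j ∧ j ≠ k ∧ i ≠ k) (hγ : γ ≤ τ) :
    normTower ((stage i₀ α β 0).map L.toMonoidHom) γ = (stage i₀ α β γ).map L.toMonoidHom :=
  normTower_map_eq L (stage i₀ α β) τ
    (fun _ h => normalizer_stage (hτ.imp_left h.trans_le) (h.le.trans hτα) hι)
    (fun _ _ h h' => stage_mono (hτ.imp_left h'.trans) h)
    (fun _ h hl _ => exists_mem_stage_of_isSuccLimit (hτ.imp_left h.trans) hl) γ hγ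

theorem terminalGroup_map_stage_zero_of_subsingleton [Subsingleton ι]
    (L : Equiv.Perm (LabelSet i₀ α β) ≃* A) :
    terminalGroup ((stage i₀ α β 0).map L.toMonoidHom) = (stage i₀ α β α).map L.toMonoidHom := by
  have hι : Subsingleton ι := inferInstance
  have h := normTower_map_stage (γ := α) L (Or.inr hι) le_rfl (Or.inl hι) le_rfl
  rw [terminalGroup_eq_of_stable
      (δ := α) fun γ hγ => normTower_stable_of_normalizer_eq ?_ γ hγ.le, h]
  rw [h]
  refine (Subgroup.map_equiv_normalizer_eq _ L).symm.trans ?_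
  rw [normalizer_stage (Or.inr hι) le_rfl (Or.inl hι),
    stage_self_eq_of_subsingleton (Order.lt_add_one_iff.2 le_rfl).le]

theorem normTower_map_stage_stable (L : Equiv.Perm (LabelSet i₀ α β) ≃* A) (hβ : β ≠ 0)
    (hβα : β ≤ α) (hι : ∀ i : ι, ∃ j k, i ≠ j ∧ j ≠ k ∧ i ≠ k) (hγ : β ≤ γ) :
    normTower ((stage i₀ α β 0).map L.toMonoidHom) γ =
      normTower ((stage i₀ α β 0).map L.toMonoidHom) β := by
  refine normTower_stable_of_normalizer_eq ?_ γ hγ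
  rw [normTower_map_stage L (Or.inl le_rfl) hβα (Or.inr hι) le_rfl]
  refine (Subgroup.map_equiv_normalizer_eq _ L).symm.trans ?_
  rw [normalizer_stage_self hβ hβα hι]

theorem terminalGroup_map_stage_zero (L : Equiv.Perm (LabelSet i₀ α β) ≃* A) (hβ : β ≠ 0)
    (hβα : β ≤ α) (hι : ∀ i : ι, ∃ j k, i ≠ j ∧ j ≠ k ∧ i ≠ k) :
    terminalGroup ((stage i₀ α β 0).map L.toMonoidHom) = (stage i₀ α β β).map L.toMonoidHom := by
  rw [terminalGroup_eq_of_stable fun γ hγ => normTower_map_stage_stable L hβ hβα hι hγ.le,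
    normTower_map_stage L (Or.inl le_rfl) hβα (Or.inr hι) le_rfl]

theorem terminatesInExactly_map_stage_zero (L : Equiv.Perm (LabelSet i₀ α β) ≃* A) (hβ : β ≠ 0)
    (hβα : β ≤ α) (hι : ∀ i : ι, ∃ j k, i ≠ j ∧ j ≠ k ∧ i ≠ k) :
    TerminatesInExactly ((stage i₀ α β 0).map L.toMonoidHom) β := by
  refine ⟨fun γ hγ => normTower_map_stage_stable L hβ hβα hι hγ.le, fun δ hδ => ?_⟩
  by_contra! hlt
  have h := hδ β hlt
  rw [normTower_map_stage L (Or.inl le_rfl) hβα (Or.inr hι) le_rfl,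
    normTower_map_stage L (Or.inl le_rfl) hβα (Or.inr hι) hlt.le] at h
  exact stage_ne (Or.inl le_rfl) hβα hlt (Subgroup.map_injective L.injective h).symm

end LabelSet

/-! ### Automorphisms of a disjoint union of copies of a connected rigid graph -/

section Models

variable {V : Type*} {Γ : SimpleGraph V} {W W' : Type*} {𝒢 : SimpleGraph W} {ℋ : SimpleGraph W'}
  {X X' : Type*}

/-- An identification of a graph with the disjoint union of copies of `Γ` indexed by `X`. -/
structure CopiesModel (Γ : SimpleGraph V) (𝒢 : SimpleGraph W) (X : Type*) where
  /-- the identification of the vertices -/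
  e : W ≃ X × V
  adj : ∀ a b, 𝒢.Adj a b ↔ (e a).1 = (e b).1 ∧ Γ.Adj (e a).2 (e b).2

namespace CopiesModel

theorem adj_symm (m : CopiesModel Γ 𝒢 X) (p q : X × V) :
    𝒢.Adj (m.e.symm p) (m.e.symm q) ↔ p.1 = q.1 ∧ Γ.Adj p.2 q.2 := by
  rw [m.adj]; simp

/-- The automorphism permuting the copies of `Γ`. -/
def lift (m : CopiesModel Γ 𝒢 X) (σ : Equiv.Perm X) : 𝒢 ≃g 𝒢 where
  toEquiv := m.e.trans ((Equiv.prodCongr σ (Equiv.refl V)).trans m.e.symm)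
  map_rel_iff' {a b} := by
    simp [m.adj]

theorem lift_apply (m : CopiesModel Γ 𝒢 X) (σ : Equiv.Perm X) (a : W) :
    m.lift σ a = m.e.symm (σ (m.e a).1, (m.e a).2) := rfl

theorem lift_symm_apply (m : CopiesModel Γ 𝒢 X) (σ : Equiv.Perm X) (x : X) (v : V) :
    m.lift σ (m.e.symm (x, v)) = m.e.symm (σ x, v) := by simp [lift_apply]

theorem lift_injective [Nonempty V] (m : CopiesModel Γ 𝒢 X) : Function.Injective m.lift := by
  intro σ τ h
  ext x
  obtain ⟨v⟩ := ‹Nonempty V›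
  have h1 : m.lift σ (m.e.symm (x, v)) = m.lift τ (m.e.symm (x, v)) := by rw [h]
  rw [lift_symm_apply, lift_symm_apply] at h1
  exact congrArg Prod.fst (m.e.symm.injective h1)

/-- An automorphism maps each copy of `Γ` into a copy. -/
theorem fst_apply_eq (m : CopiesModel Γ 𝒢 X) (hconn : Γ.Connected) (g : 𝒢 ≃g 𝒢) (x : X)
    (v w : V) : (m.e (g (m.e.symm (x, v)))).1 = (m.e (g (m.e.symm (x, w)))).1 := by
  obtain ⟨p⟩ := hconn.preconnected v w
  induction p with
  | nil => rfl
  | @cons u w _ h _ ih =>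
    refine Eq.trans ?_ ih
    exact ((m.adj _ _).1 (g.map_adj_iff.2 ((m.adj_symm (x, u) (x, w)).2 ⟨rfl, h⟩))).1

/-- By connectedness an automorphism sends copies into copies, and so does its inverse, giving a
permutation `σ` of the copies. What remains on each copy is an automorphism of `Γ`, trivial by
rigidity. -/
theorem lift_surjective (m : CopiesModel Γ 𝒢 X) (hconn : Γ.Connected) (hrigid : IsRigid Γ) :
    Function.Surjective m.lift := by
  intro g
  obtain ⟨v₀⟩ := hconn.nonempty
  have key : ∀ (g : 𝒢 ≃g 𝒢) x v, m.e (g.symm (m.e.symm ((m.e (g (m.e.symm (x, v₀)))).1, v))) =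
      (x, (m.e (g.symm (m.e.symm ((m.e (g (m.e.symm (x, v₀)))).1, v)))).2) := by
    intro g x v
    refine Prod.ext ?_ rfl
    rw [m.fst_apply_eq hconn g.symm _ v (m.e (g (m.e.symm (x, v₀)))).2]
    simp
  let σ : Equiv.Perm X :=
    { toFun := fun x => (m.e (g (m.e.symm (x, v₀)))).1
      invFun := fun x => (m.e (g.symm (m.e.symm (x, v₀)))).1
      left_inv := fun x => congrArg Prod.fst (key g x v₀)
      right_inv := fun x => congrArg Prod.fst (key g.symm x v₀) }
  refine ⟨σ, ?_⟩
  have hσ : ∀ x v, (m.e (g (m.e.symm (x, v)))).1 = σ x := fun x v => m.fst_apply_eq hconn g x v v₀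
  have hg : ∀ x v, m.e (g (m.e.symm (x, v))) = (σ x, (m.e (g (m.e.symm (x, v)))).2) :=
    fun x v => Prod.ext (hσ x v) rfl
  have hk : ∀ x v, m.e (g.symm (m.e.symm (σ x, v))) =
      (x, (m.e (g.symm (m.e.symm (σ x, v)))).2) := fun x v => key g x v
  have hτ : ∀ x v, (m.e (g (m.e.symm (x, v)))).2 = v := by
    intro x v
    let τ : Γ ≃g Γ :=
      { toFun := fun v => (m.e (g (m.e.symm (x, v)))).2
        invFun := fun v => (m.e (g.symm (m.e.symm (σ x, v)))).2
        left_inv := fun v => by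
          show (m.e (g.symm (m.e.symm (σ x, (m.e (g (m.e.symm (x, v)))).2)))).2 = v
          rw [← hg]; simp
        right_inv := fun v => by
          show (m.e (g (m.e.symm (x, (m.e (g.symm (m.e.symm (σ x, v)))).2)))).2 = v
          rw [← hk]; simp
        map_rel_iff' := fun {a b} => by
          show Γ.Adj (m.e (g (m.e.symm (x, a)))).2 (m.e (g (m.e.symm (x, b)))).2 ↔ _
          have h1 := m.adj (g (m.e.symm (x, a))) (g (m.e.symm (x, b)))
          rw [g.map_adj_iff, m.adj_symm, hσ, hσ] at h1
          simpa using h1.symm }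
    have := congrArg (fun t : Γ ≃g Γ => t v) (hrigid τ)
    exact this
  ext a
  obtain ⟨⟨x, v⟩, rfl⟩ := m.e.symm.surjective a
  rw [lift_symm_apply]
  apply m.e.injective
  rw [hg, hτ]; simp

/-- The automorphism group of a disjoint union of copies of a connected rigid graph is the symmetric
group on the set of copies. -/
noncomputable def liftEquiv (m : CopiesModel Γ 𝒢 X) (hconn : Γ.Connected) (hrigid : IsRigid Γ) :
    Equiv.Perm X ≃* (𝒢 ≃g 𝒢) :=
  MulEquiv.ofBijective
    ({ toFun := m.lift
       map_one' := by ext a; simp [lift_apply]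
       map_mul' := fun σ τ => by ext a; simp [lift_apply, RelIso.mul_apply] } :
      Equiv.Perm X →* (𝒢 ≃g 𝒢))
    ⟨have := hconn.nonempty; m.lift_injective, m.lift_surjective hconn hrigid⟩

/-- Reindexing the copies of `Γ`. -/
def map (m : CopiesModel Γ 𝒢 X) (f : X ≃ X') : CopiesModel Γ 𝒢 X' where
  e := m.e.trans (Equiv.prodCongr f (Equiv.refl V))
  adj a b := by simp [m.adj]

theorem map_lift (m : CopiesModel Γ 𝒢 X) (f : X ≃ X') (σ : Equiv.Perm X) :
    (m.map f).lift (f.permCongr σ) = m.lift σ := by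
  ext a
  simp [lift_apply, map]

/-- The disjoint union of two disjoint unions of copies of `Γ`. -/
def sum (m : CopiesModel Γ 𝒢 X) (m' : CopiesModel Γ ℋ X') :
    CopiesModel Γ (𝒢 ⊕g ℋ) (X ⊕ X') where
  e := (Equiv.sumCongr m.e m'.e).trans (Equiv.sumProdDistrib X X' V).symm
  adj a b := by
    rcases a with a | a <;> rcases b with b | b <;> simp [m.adj, m'.adj]

/-- A disjoint union of disjoint unions of copies of `Γ`. -/
def sigma {I : Type*} {W : I → Type*} {𝒢 : ∀ i, SimpleGraph (W i)} {X : I → Type*}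
    (m : ∀ i, CopiesModel Γ (𝒢 i) (X i)) : CopiesModel Γ (graphSum 𝒢) (Σ i, X i) where
  e := (Equiv.sigmaCongrRight fun i => (m i).e).trans (Equiv.sigmaProdDistrib X V).symm
  adj a b := by
    obtain ⟨i, a⟩ := a
    obtain ⟨j, b⟩ := b
    constructor
    · rintro ⟨k, a', b', h, h1, h2⟩
      cases h1
      cases h2
      simpa using ((m i).adj _ _).1 h
    · simp only [Equiv.trans_apply, Equiv.sigmaCongrRight_apply]
      rintro ⟨h1, h2⟩
      have h1' : (⟨i, ((m i).e a).1⟩ : Σ i, X i) = ⟨j, ((m j).e b).1⟩ := h1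
      have h2' : Γ.Adj ((m i).e a).2 ((m j).e b).2 := h2
      obtain rfl := congrArg Sigma.fst h1'
      exact ⟨i, a, b, ((m i).adj _ _).2 ⟨by simpa using h1', h2'⟩, rfl, rfl⟩

theorem sigma_e_symm {I : Type*} {W : I → Type*} {𝒢 : ∀ i, SimpleGraph (W i)} {X : I → Type*}
    (m : ∀ i, CopiesModel Γ (𝒢 i) (X i)) (i : I) (x : X i) (v : V) :
    (sigma m).e.symm (⟨i, x⟩, v) = ⟨i, (m i).e.symm (x, v)⟩ := rfl

theorem sum_e_symm_inl (m : CopiesModel Γ 𝒢 X) (m' : CopiesModel Γ ℋ X') (x : X) (v : V) :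
    (m.sum m').e.symm (Sum.inl x, v) = Sum.inl (m.e.symm (x, v)) := rfl

theorem sum_e_symm_inr (m : CopiesModel Γ 𝒢 X) (m' : CopiesModel Γ ℋ X') (x : X') (v : V) :
    (m.sum m').e.symm (Sum.inr x, v) = Sum.inr (m'.e.symm (x, v)) := rfl

/-- Two graphs identified with the same disjoint union of copies of `Γ` are isomorphic. -/
def iso (m : CopiesModel Γ 𝒢 X) (m' : CopiesModel Γ ℋ X) : 𝒢 ≃g ℋ where
  toEquiv := m.e.trans m'.e.symm
  map_rel_iff' {a b} := by
    simp [m.adj, m'.adj]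

theorem iso_conj_lift (m : CopiesModel Γ 𝒢 X) (m' : CopiesModel Γ ℋ X) (σ : Equiv.Perm X) :
    ((m.iso m').symm.trans (m.lift σ)).trans (m.iso m') = m'.lift σ := by
  ext a
  show m'.e.symm (m.e (m.lift σ (m.e.symm (m'.e a)))) = _
  simp [lift_apply]

end CopiesModel

end Models

/-! ### Products and wreath products as coloured isometry groups -/

namespace CopiesModel

variable {V : Type*} {Γ : SimpleGraph V}

/-- The group of `P` consists of the automorphisms permuting the copies of `Γ` by an element
of `K`. -/
def Represents (P : PermGraph.{u}) {X : Type*} (m : CopiesModel Γ P.graph X)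
    (K : Subgroup (Equiv.Perm X)) : Prop :=
  ∀ σ, m.lift σ ∈ P.grp ↔ σ ∈ K

section

variable {P Q : PermGraph.{u}} {X X' : Type*} {m : CopiesModel Γ P.graph X}
  {m' : CopiesModel Γ Q.graph X'}

theorem Represents.grp_eq {K : Subgroup (Equiv.Perm X)} (h : Represents P m K)
    (hconn : Γ.Connected) (hrigid : IsRigid Γ) :
    P.grp = K.map (m.liftEquiv hconn hrigid).toMonoidHom := by
  ext g
  obtain ⟨σ, rfl⟩ := m.lift_surjective hconn hrigid g
  rw [h σ]
  constructor
  · exact fun hσ => ⟨σ, hσ, rfl⟩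
  · rintro ⟨τ, hτ, h'⟩
    obtain rfl : τ = σ := (m.liftEquiv hconn hrigid).injective h'
    exact hτ

theorem represents_of_grp_eq {K : Subgroup (Equiv.Perm X)} (hconn : Γ.Connected)
    (hrigid : IsRigid Γ) (h : P.grp = K.map (m.liftEquiv hconn hrigid).toMonoidHom) :
    Represents P m K := by
  intro σ
  rw [h]
  constructor
  · rintro ⟨τ, hτ, h'⟩
    obtain rfl : τ = σ := (m.liftEquiv hconn hrigid).injective h'
    exact hτ
  · exact fun hσ => ⟨σ, hσ, rfl⟩

theorem Represents.isPermIso {K : Subgroup (Equiv.Perm X)} {n : CopiesModel Γ Q.graph X}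
    (h : Represents P m K) (h' : Represents Q n K) (hconn : Γ.Connected) (hrigid : IsRigid Γ) :
    PermGraph.IsPermIso (P := P) (Q := Q) (m.iso n) := by
  intro g
  obtain ⟨σ, rfl⟩ := m.lift_surjective hconn hrigid g
  rw [iso_conj_lift, h σ, h' σ]

theorem Represents.map {C : Type*} {D : Type*} {c : X' → C} {d : X' → X' → D} (f : X ≃ X')
    (h : Represents P m (colorIsom (fun x => c (f x)) fun x y => d (f x) (f y))) :
    Represents P (m.map f) (colorIsom c d) := by
  intro σ
  obtain ⟨τ, rfl⟩ := f.permCongr.surjective σ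
  rw [map_lift, h τ]
  exact mem_colorIsom_congr f (fun _ _ => Iff.rfl) (fun _ _ _ => rfl) τ

theorem exists_perm_of_forall_inl {σ : Equiv.Perm (X ⊕ X')}
    (h1 : ∀ x, ∃ x', σ (Sum.inl x) = Sum.inl x') (h2 : ∀ x, ∃ x', σ (Sum.inr x) = Sum.inr x') :
    ∃ (a : Equiv.Perm X) (b : Equiv.Perm X'), (∀ x, σ (Sum.inl x) = Sum.inl (a x)) ∧
      ∀ x, σ (Sum.inr x) = Sum.inr (b x) := by
  choose a ha using h1
  choose b hb using h2
  have ha' : Function.Bijective a := by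
    refine ⟨fun x y hxy => ?_, fun y => ?_⟩
    · have := (ha x).trans ((congrArg Sum.inl hxy).trans (ha y).symm)
      exact Sum.inl_injective (σ.injective this)
    · obtain ⟨x | x, hx⟩ := σ.surjective (Sum.inl y)
      · exact ⟨x, Sum.inl_injective ((ha x).symm.trans hx)⟩
      · exact absurd ((hb x).symm.trans hx) (by simp)
  have hb' : Function.Bijective b := by
    refine ⟨fun x y hxy => ?_, fun y => ?_⟩
    · have := (hb x).trans ((congrArg Sum.inr hxy).trans (hb y).symm)
      exact Sum.inr_injective (σ.injective this)
    · obtain ⟨x | x, hx⟩ := σ.surjective (Sum.inr y)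
      · exact absurd ((ha x).symm.trans hx) (by simp)
      · exact ⟨x, Sum.inr_injective ((hb x).symm.trans hx)⟩
  exact ⟨Equiv.ofBijective a ha', Equiv.ofBijective b hb', ha, hb⟩

/-- Preserving colours forces preserving the summands because they share no colour. Distances across
colours are irrelevant, so the colouring and distance on the union need only restrict correctly. -/
theorem Represents.sum {C C₁ C₂ D : Type*} {c₁ : X → C₁} {c₂ : X' → C₂} {d₁ : X → X → D}
    {d₂ : X' → X' → D} {c : X ⊕ X' → C} {d : X ⊕ X' → X ⊕ X' → D}
    (hP : Represents P m (colorIsom c₁ d₁)) (hQ : Represents Q m' (colorIsom c₂ d₂))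
    (hconn : Γ.Connected) (hrigid : IsRigid Γ)
    (hc₁ : ∀ x y, c (Sum.inl x) = c (Sum.inl y) ↔ c₁ x = c₁ y)
    (hc₂ : ∀ x y, c (Sum.inr x) = c (Sum.inr y) ↔ c₂ x = c₂ y)
    (hc : ∀ x y, c (Sum.inl x) ≠ c (Sum.inr y))
    (hd₁ : ∀ x y, c₁ x = c₁ y → d (Sum.inl x) (Sum.inl y) = d₁ x y)
    (hd₂ : ∀ x y, c₂ x = c₂ y → d (Sum.inr x) (Sum.inr y) = d₂ x y) :
    Represents (P.prod Q) (m.sum m') (colorIsom c d) := by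
  obtain ⟨v₀⟩ := hconn.nonempty
  have key : ∀ (σ : Equiv.Perm (X ⊕ X')) (a : Equiv.Perm X) (b : Equiv.Perm X'),
      (∀ x, σ (Sum.inl x) = Sum.inl (a x)) → (∀ x, σ (Sum.inr x) = Sum.inr (b x)) →
      (σ ∈ colorIsom c d ↔ a ∈ colorIsom c₁ d₁ ∧ b ∈ colorIsom c₂ d₂) := by
    intro σ a b ha hb
    constructor
    · rintro ⟨h1, h2⟩
      have h1a : ∀ x, c₁ (a x) = c₁ x := fun x => by rw [← hc₁, ← ha, h1]
      have h1b : ∀ x, c₂ (b x) = c₂ x := fun x => by rw [← hc₂, ← hb, h1]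
      refine ⟨⟨h1a, fun x y hxy => ?_⟩, ⟨h1b, fun x y hxy => ?_⟩⟩
      · rw [← hd₁ _ _ (by rwa [h1a, h1a]), ← ha, ← ha, h2 _ _ ((hc₁ _ _).2 hxy), hd₁ _ _ hxy]
      · rw [← hd₂ _ _ (by rwa [h1b, h1b]), ← hb, ← hb, h2 _ _ ((hc₂ _ _).2 hxy), hd₂ _ _ hxy]
    · rintro ⟨⟨h1, h2⟩, h3, h4⟩
      refine ⟨?_, ?_⟩
      · rintro (x | x)
        · rw [ha, hc₁, h1]
        · rw [hb, hc₂, h3]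
      · rintro (x | x) (y | y) hxy
        · rw [hc₁] at hxy
          rw [ha, ha, hd₁ _ _ (by rwa [h1, h1]), hd₁ _ _ hxy, h2 _ _ hxy]
        · exact absurd hxy (hc _ _)
        · exact absurd hxy.symm (hc _ _)
        · rw [hc₂] at hxy
          rw [hb, hb, hd₂ _ _ (by rwa [h3, h3]), hd₂ _ _ hxy, h4 _ _ hxy]
  intro σ
  constructor
  · rintro ⟨g, hg, k, hk, h1, h2⟩
    obtain ⟨a, rfl⟩ := m.lift_surjective hconn hrigid g
    obtain ⟨b, rfl⟩ := m'.lift_surjective hconn hrigid k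
    refine (key σ a b (fun x => ?_) fun x => ?_).2 ⟨(hP a).1 hg, (hQ b).1 hk⟩
    · have := h1 (m.e.symm (x, v₀))
      rw [lift_symm_apply, ← sum_e_symm_inl m m', ← sum_e_symm_inl m m'] at this
      have h3 := ((m.sum m').lift_symm_apply σ _ _).symm.trans this
      exact congrArg Prod.fst ((m.sum m').e.symm.injective h3)
    · have := h2 (m'.e.symm (x, v₀))
      rw [lift_symm_apply, ← sum_e_symm_inr m m', ← sum_e_symm_inr m m'] at this
      have h3 := ((m.sum m').lift_symm_apply σ _ _).symm.trans this
      exact congrArg Prod.fst ((m.sum m').e.symm.injective h3)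
  · intro hσ
    obtain ⟨a, b, ha, hb⟩ := exists_perm_of_forall_inl (σ := σ)
      (fun x => by
        have := hσ.1 (Sum.inl x)
        rcases h : σ (Sum.inl x) with y | y
        · exact ⟨y, rfl⟩
        · exact absurd (h ▸ this).symm (hc _ _))
      (fun x => by
        have := hσ.1 (Sum.inr x)
        rcases h : σ (Sum.inr x) with y | y
        · exact absurd (h ▸ this) (hc _ _)
        · exact ⟨y, rfl⟩)
    have hab := (key σ a b ha hb).1 hσ
    refine ⟨m.lift a, (hP a).2 hab.1, m'.lift b, (hQ b).2 hab.2, fun x => ?_, fun x => ?_⟩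
    · obtain ⟨⟨x, v⟩, rfl⟩ := m.e.symm.surjective x
      rw [lift_symm_apply, ← sum_e_symm_inl m m', ← sum_e_symm_inl m m', ← ha]
      exact (m.sum m').lift_symm_apply σ _ _
    · obtain ⟨⟨x, v⟩, rfl⟩ := m'.e.symm.surjective x
      rw [lift_symm_apply, ← sum_e_symm_inr m m', ← sum_e_symm_inr m m', ← hb]
      exact (m.sum m').lift_symm_apply σ _ _

end

theorem exists_perm_of_forall_fst {I : Type*} {X : I → Type*} {σ : Equiv.Perm (Σ i, X i)}
    (h : ∀ p, (σ p).1 = p.1) :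
    ∃ a : ∀ i, Equiv.Perm (X i), ∀ i x, σ ⟨i, x⟩ = ⟨i, a i x⟩ := by
  have h' : ∀ i x, ∃ y, σ ⟨i, x⟩ = ⟨i, y⟩ := by
    intro i x
    have := h ⟨i, x⟩
    rcases hp : σ ⟨i, x⟩ with ⟨j, y⟩
    rw [hp] at this
    obtain rfl : j = i := this
    exact ⟨y, rfl⟩
  choose a ha using h'
  have hb : ∀ i, Function.Bijective (a i) := by
    refine fun i => ⟨fun x y hxy => ?_, fun y => ?_⟩
    · have := (ha i x).trans ((congrArg (Sigma.mk i) hxy).trans (ha i y).symm)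
      exact sigma_mk_injective (σ.injective this)
    · obtain ⟨⟨j, x⟩, hx⟩ := σ.surjective ⟨i, y⟩
      rw [ha] at hx
      obtain rfl := congrArg Sigma.fst hx
      exact ⟨x, sigma_mk_injective hx⟩
  exact ⟨fun i => Equiv.ofBijective (a i) (hb i), ha⟩

theorem Represents.sigma {I : Type v} {P : I → PermGraph.{u}} {X : I → Type*}
    {m : ∀ i, CopiesModel Γ (P i).graph (X i)} {C D : Type*} {C' : I → Type*}
    {c' : ∀ i, X i → C' i} {d' : ∀ i, X i → X i → D} {c : (Σ i, X i) → C}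
    {d : (Σ i, X i) → (Σ i, X i) → D}
    (hP : ∀ i, Represents (P i) (m i) (colorIsom (c' i) (d' i)))
    (hconn : Γ.Connected) (hrigid : IsRigid Γ)
    (hc' : ∀ i x y, c ⟨i, x⟩ = c ⟨i, y⟩ ↔ c' i x = c' i y)
    (hc : ∀ p q, c p = c q → p.1 = q.1)
    (hd : ∀ i x y, c' i x = c' i y → d ⟨i, x⟩ ⟨i, y⟩ = d' i x y) :
    Represents (PermGraph.pi P) (CopiesModel.sigma m) (colorIsom c d) := by
  obtain ⟨v₀⟩ := hconn.nonempty
  have key : ∀ (σ : Equiv.Perm (Σ i, X i)) (a : ∀ i, Equiv.Perm (X i)),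
      (∀ i x, σ ⟨i, x⟩ = ⟨i, a i x⟩) →
      (σ ∈ colorIsom c d ↔ ∀ i, a i ∈ colorIsom (c' i) (d' i)) := by
    intro σ a ha
    constructor
    · rintro ⟨h1, h2⟩ i
      have h1a : ∀ x, c' i (a i x) = c' i x := fun x => by rw [← hc', ← ha, h1]
      refine ⟨h1a, fun x y hxy => ?_⟩
      rw [← hd _ _ _ (by rwa [h1a, h1a]), ← ha, ← ha, h2 _ _ ((hc' _ _ _).2 hxy), hd _ _ _ hxy]
    · intro h
      refine ⟨fun ⟨i, x⟩ => by rw [ha, hc', (h i).1], ?_⟩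
      rintro ⟨i, x⟩ ⟨j, y⟩ hxy
      obtain rfl : i = j := hc _ _ hxy
      rw [hc'] at hxy
      rw [ha, ha, hd _ _ _ (by rwa [(h i).1, (h i).1]), hd _ _ _ hxy, (h i).2 _ _ hxy]
  intro σ
  constructor
  · rintro ⟨g, hg, h1⟩
    choose a ha using fun i => (m i).lift_surjective hconn hrigid (g i)
    refine (key σ a fun i x => ?_).2 fun i => (hP i _).1 (by rw [ha]; exact hg i)
    have := h1 i ((m i).e.symm (x, v₀))
    rw [← ha, lift_symm_apply, ← sigma_e_symm m, ← sigma_e_symm m] at this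
    have h3 := ((CopiesModel.sigma m).lift_symm_apply σ _ _).symm.trans this
    exact congrArg Prod.fst ((CopiesModel.sigma m).e.symm.injective h3)
  · intro hσ
    obtain ⟨a, ha⟩ := exists_perm_of_forall_fst fun p => hc _ _ (hσ.1 p)
    refine ⟨fun i => (m i).lift (a i), fun i => (hP i _).2 ((key σ a ha).1 hσ i), fun i x => ?_⟩
    obtain ⟨⟨x, v⟩, rfl⟩ := (m i).e.symm.surjective x
    rw [lift_symm_apply, ← sigma_e_symm m, ← sigma_e_symm m, ← ha]
    exact (CopiesModel.sigma m).lift_symm_apply σ _ _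

theorem exists_perm_of_forall_fst_iff {I X : Type*} [Nonempty X] {σ : Equiv.Perm (Σ _ : I, X)}
    (h : ∀ p q, (σ p).1 = (σ q).1 ↔ p.1 = q.1) :
    ∃ (π : Equiv.Perm I) (a : I → Equiv.Perm X), ∀ i x, σ ⟨i, x⟩ = ⟨π i, a i x⟩ := by
  obtain ⟨x₀⟩ := ‹Nonempty X›
  have hσ : ∀ i x, σ ⟨i, x⟩ = ⟨(σ ⟨i, x₀⟩).1, (σ ⟨i, x⟩).2⟩ := fun i x => by
    have := (h ⟨i, x⟩ ⟨i, x₀⟩).2 rfl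
    rw [← this]
  have hπ : Function.Bijective fun i => (σ ⟨i, x₀⟩).1 := by
    refine ⟨fun i j hij => (h ⟨i, x₀⟩ ⟨j, x₀⟩).1 hij, fun j => ?_⟩
    obtain ⟨⟨i, x⟩, hx⟩ := σ.surjective ⟨j, x₀⟩
    refine ⟨i, ?_⟩
    rw [hσ] at hx
    exact congrArg Sigma.fst hx
  have ha : ∀ i, Function.Bijective fun x => (σ ⟨i, x⟩).2 := by
    refine fun i => ⟨fun x y hxy => ?_, fun y => ?_⟩
    · have h1 := hσ i x
      rw [show (σ ⟨i, x⟩).2 = (σ ⟨i, y⟩).2 from hxy, ← hσ i y] at h1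
      exact sigma_mk_injective (σ.injective h1)
    · obtain ⟨⟨j, x⟩, hx⟩ := σ.surjective ⟨(σ ⟨i, x₀⟩).1, y⟩
      obtain rfl : j = i := (h ⟨j, x⟩ ⟨i, x₀⟩).1 (by rw [hx])
      exact ⟨x, by simp only [hx]⟩
  exact ⟨Equiv.ofBijective _ hπ, fun i => Equiv.ofBijective _ (ha i), hσ⟩

/-- With a single colour, the value `b`, attained exactly between different copies, lets the
distance recover the partition into copies. An isometry must therefore permute the copies, and any
permutation of them is allowed. -/
theorem Represents.wreathSym {I : Type v} {P : PermGraph.{u}} {X : Type*} [Nonempty X]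
    {m : CopiesModel Γ P.graph X} {C C' D : Type*} {c' : X → C'} {d' : X → X → D}
    {c : (Σ _ : I, X) → C} {d : (Σ _ : I, X) → (Σ _ : I, X) → D} {b : D}
    (hP : Represents P m (colorIsom c' d')) (hconn : Γ.Connected) (hrigid : IsRigid Γ)
    (hc' : ∀ x y, c' x = c' y) (hc : ∀ p q, c p = c q)
    (hd : ∀ i x y, d ⟨i, x⟩ ⟨i, y⟩ = d' x y) (hb : ∀ x y, d' x y ≠ b)
    (hd' : ∀ i j x y, i ≠ j → d ⟨i, x⟩ ⟨j, y⟩ = b) :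
    Represents (P.wreathSym I) (CopiesModel.sigma fun _ : I => m) (colorIsom c d) := by
  obtain ⟨v₀⟩ := hconn.nonempty
  have hdb : ∀ p q, d p q = b ↔ p.1 ≠ q.1 := by
    rintro ⟨i, x⟩ ⟨j, y⟩
    by_cases h : i = j
    · subst h
      rw [hd]
      exact ⟨fun h => absurd h (hb x y), fun h => absurd rfl h⟩
    · rw [hd' _ _ _ _ h]
      exact ⟨fun _ => h, fun _ => rfl⟩
  have key : ∀ (σ : Equiv.Perm (Σ _ : I, X)) (π : Equiv.Perm I) (a : I → Equiv.Perm X),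
      (∀ i x, σ ⟨i, x⟩ = ⟨π i, a i x⟩) →
      (σ ∈ colorIsom c d ↔ ∀ i, a i ∈ colorIsom c' d') := by
    intro σ π a ha
    constructor
    · rintro ⟨-, h2⟩ i
      refine ⟨fun x => hc' _ _, fun x y _ => ?_⟩
      rw [← hd (π i), ← ha, ← ha, h2 _ _ (hc _ _), hd]
    · intro h
      refine ⟨fun p => hc _ _, ?_⟩
      rintro ⟨i, x⟩ ⟨j, y⟩ -
      rw [ha, ha]
      by_cases hij : i = j
      · subst hij
        rw [hd, hd, (h i).2 _ _ (hc' _ _)]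
      · rw [hd' _ _ _ _ hij, hd' _ _ _ _ fun h => hij (π.injective h)]
  intro σ
  constructor
  · rintro ⟨π, g, hg, h1⟩
    choose a ha using fun i => m.lift_surjective hconn hrigid (g i)
    refine (key σ π a fun i x => ?_).2 fun i => (hP _).1 (by rw [ha]; exact hg i)
    have := h1 i (m.e.symm (x, v₀))
    rw [← ha, lift_symm_apply, ← sigma_e_symm fun _ : I => m,
      ← sigma_e_symm fun _ : I => m] at this
    have h3 := ((CopiesModel.sigma fun _ : I => m).lift_symm_apply σ _ _).symm.trans this
    exact congrArg Prod.fst ((CopiesModel.sigma fun _ : I => m).e.symm.injective h3)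
  · intro hσ
    obtain ⟨π, a, ha⟩ := exists_perm_of_forall_fst_iff (σ := σ) fun p q => by
      rw [← not_iff_not, ← ne_eq, ← ne_eq, ← hdb, ← hdb, hσ.2 _ _ (hc _ _)]
    refine ⟨π, fun i => m.lift (a i), fun i => (hP _).2 ((key σ π a ha).1 hσ i), fun i x => ?_⟩
    obtain ⟨⟨x, v⟩, rfl⟩ := m.e.symm.surjective x
    rw [lift_symm_apply, ← sigma_e_symm fun _ : I => m, ← sigma_e_symm fun _ : I => m, ← ha]
    exact (CopiesModel.sigma fun _ : I => m).lift_symm_apply σ _ _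

end CopiesModel

/-! ### The pieces of the index set with given maximum and label -/

namespace LabelSet

/-- The finite sets of ordinals less than `α`. -/
abbrev FinSets (α : Ordinal.{u}) : Type (u + 1) :=
  LabelSet PUnit.unit.{1} α 0

variable {ι : Type v} [DecidableEq ι] {i₀ : ι} {α α' β γ δ : Ordinal.{u}}

instance : Unique (FinSets.{u} 0) where
  default := ⟨PUnit.unit, ∅, WithBot.bot_lt_coe _, fun h => absurd rfl h⟩
  uniq x := by
    have hx : x.set = ∅ := by
      rw [← Finset.max_eq_bot]
      have h := x.max_lt
      generalize x.set.max = m at h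
      induction m with
      | bot => rfl
      | coe a => exact absurd (WithBot.coe_lt_coe.1 h) (by simp)
    exact ext' rfl hx

instance : Nonempty (FinSets.{u} α) :=
  ⟨⟨PUnit.unit, ∅, WithBot.bot_lt_coe _, fun h => absurd rfl h⟩⟩

/-- Finite sets of ordinals as sets with label `i₀`. -/
def base (h : α' ≤ α) (x : FinSets α') : LabelSet i₀ α β :=
  ⟨i₀, x.set, x.max_lt.trans_le (WithBot.coe_le_coe.2 h), fun h => absurd rfl h⟩

/-- The labelled set obtained by adding the maximum `γ` and the label `i`. -/
noncomputable def top (γ : Ordinal.{u}) (hγ : γ < α) (i : ι) (hi : i ≠ i₀ → γ = β)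
    (x : FinSets γ) : LabelSet i₀ α β :=
  have h : (insert γ x.set).max = γ := by rw [Finset.max_insert, max_eq_left x.max_lt.le]
  ⟨i, insert γ x.set, by rw [h]; exact WithBot.coe_lt_coe.2 hγ, fun h' => by rw [h, hi h']⟩

theorem top_max {ι : Type v} {i₀ : ι} (hγ : γ < α) (i : ι) (hi : i ≠ i₀ → γ = β) (x : FinSets γ) :
    (top γ hγ i hi x).set.max = γ := by
  show (insert γ x.set).max = γ
  rw [Finset.max_insert, max_eq_left x.max_lt.le]

theorem notMem_set (x : FinSets γ) : γ ∉ x.set := fun h =>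
  absurd (Finset.le_max h) (not_le.2 x.max_lt)

/-- The added maximum is common to both sets and cancels, so adding it is an isometry. -/
theorem symmDiff_top {ι : Type v} {i₀ : ι} (hγ : γ < α) (i j : ι) (hi : i ≠ i₀ → γ = β) (hj :
    j ≠ i₀ → γ = β)
    (x y : FinSets γ) :
    symmDiff (top γ hγ i hi x).set (top γ hγ j hj y).set = symmDiff x.set y.set := by
  ext a
  show a ∈ symmDiff (insert γ x.set) (insert γ y.set) ↔ _
  have hx := notMem_set x
  have hy := notMem_set y
  simp only [Finset.mem_symmDiff, Finset.mem_insert]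
  by_cases h : a = γ
  · subst h; simp [hx, hy]
  · simp [h]

theorem dist_top_same (hγ : γ < α) (i : ι) (hi : i ≠ i₀ → γ = β) (x y : FinSets γ) :
    dist (top γ hγ i hi x) (top γ hγ i hi y) = dist x y := by
  rw [dist_of_eq (by rfl), dist_of_eq (by rfl), symmDiff_top]

theorem dist_top_ne (hγ : γ < α) {i j : ι} (hij : i ≠ j) (hi : i ≠ i₀ → γ = β)
    (hj : j ≠ i₀ → γ = β) (x y : FinSets γ) :
    dist (top γ hγ i hi x) (top γ hγ j hj y) = β :=
  dist_of_ne (by exact hij)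

theorem dist_base (h : α' ≤ α) (x y : FinSets α') :
    dist (base h x : LabelSet i₀ α β) (base h y) = dist x y := by
  rw [dist_of_eq (by rfl), dist_of_eq (by rfl)]; rfl

theorem dist_ne_coe (x y : FinSets γ) : dist x y ≠ γ := by
  rw [dist_of_eq (by rfl)]
  exact ((max_symmDiff_le _ _).trans_lt (_root_.max_lt x.max_lt y.max_lt)).ne

theorem color_base_eq_iff {ι : Type v} {i₀ : ι} (h : α' ≤ α) (x y : FinSets α') :
    color γ (base h x : LabelSet i₀ α β) = color γ (base h y : LabelSet i₀ α β) ↔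
      color γ x = color γ y := by
  rw [color_eq_iff, color_eq_iff]
  simp [base]

theorem color_eq_of_self (x y : FinSets γ) : color γ x = color γ y := by
  rw [color_eq_iff, cut_of_lt x.max_lt, cut_of_lt y.max_lt]
  exact ⟨fun _ => rfl, rfl⟩

theorem color_top_snd {ι : Type v} {i₀ : ι} (hδ : δ ≤ γ) (hγ : γ < α) (i : ι) (hi :
    i ≠ i₀ → γ = β) (x : FinSets γ) :
    (color δ (top γ hγ i hi x)).2 = γ := by
  show cut δ (top γ hγ i hi x).set.max = γ
  rw [top_max, cut_of_le (WithBot.coe_le_coe.2 hδ)]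

theorem color_top_eq {ι : Type v} {i₀ : ι} (hγ : γ < α) (i : ι) (hi : i ≠ i₀ → γ = β) (x y :
    FinSets γ) :
    color δ (top γ hγ i hi x) = color δ (top γ hγ i hi y) := by
  rw [color_eq_iff, top_max, top_max]
  exact ⟨fun _ => rfl, rfl⟩

theorem color_base_ne_top {ι : Type v} {i₀ : ι} (h : α' ≤ α) (h' : α' ≤ γ) (hδ : δ ≤ γ) (hγ :
    γ < α) (i : ι)
    (hi : i ≠ i₀ → γ = β) (x : FinSets α') (y : FinSets γ) :
    color δ (base h x : LabelSet i₀ α β) ≠ color δ (top γ hγ i hi y) := by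
  intro he
  have h1 := congrArg Prod.snd he
  rw [color_top_snd hδ] at h1
  have h2 : cut δ x.set.max = γ := h1
  have h3 := x.max_lt.trans_le (WithBot.coe_le_coe.2 h')
  rcases cut_cases δ x.set.max with ⟨-, e⟩ | ⟨-, e⟩ <;> rw [e] at h2
  · exact WithBot.coe_ne_bot h2.symm
  · exact h3.ne h2

theorem color_top_ne_top {ι : Type v} {i₀ : ι} (hδ : δ ≤ γ) {γ' : Ordinal.{u}} (hδ' : δ ≤ γ')
    (hγ : γ < α) (hγ' : γ' < α)
    (i j : ι) (hi : i ≠ i₀ → γ = β) (hj : j ≠ i₀ → γ' = β) (x : FinSets γ) (y : FinSets γ')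
    (h : color δ (top γ hγ i hi x) = color δ (top γ' hγ' j hj y)) : γ = γ' := by
  have h1 := congrArg Prod.snd h
  rw [color_top_snd hδ, color_top_snd hδ'] at h1
  exact WithBot.coe_injective h1

theorem base_injective {ι : Type v} {i₀ : ι} (h : α' ≤ α) :
    Function.Injective (base h : FinSets α' → LabelSet i₀ α β) := fun x y hxy => by
  have hs : (base h x : LabelSet i₀ α β).set = (base h y : LabelSet i₀ α β).set := by rw [hxy]
  exact ext' rfl hs

theorem top_injective (hγ : γ < α) (i : ι) (hi : i ≠ i₀ → γ = β) :
    Function.Injective (top γ hγ i hi) := fun x y hxy => by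
  refine (dist_eq_bot _ _).1 ?_
  rw [← dist_top_same hγ i hi, hxy, (dist_eq_bot _ _).2 rfl]

theorem exists_base {ι : Type v} {i₀ : ι} (h : α' ≤ α) {y : LabelSet i₀ α β} (hi : y.label = i₀)
    (hy : y.set.max < α') : ∃ x, base h x = y :=
  ⟨⟨PUnit.unit, y.set, hy, fun h => absurd rfl h⟩, ext' hi.symm rfl⟩

theorem exists_top {ι : Type v} {i₀ : ι} (hγ : γ < α) {i : ι} (hi : i ≠ i₀ → γ = β) {y :
    LabelSet i₀ α β}
    (hl : y.label = i) (hy : y.set.max = γ) : ∃ x, top γ hγ i hi x = y := by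
  have hmem : γ ∈ y.set := Finset.mem_of_max hy
  refine ⟨⟨PUnit.unit, y.set.erase γ, ?_, fun h => absurd rfl h⟩, ext' hl.symm ?_⟩
  · refine lt_of_le_of_ne (hy ▸ Finset.max_mono (Finset.erase_subset _ _)) fun h => ?_
    exact Finset.notMem_erase γ y.set (Finset.mem_of_max h)
  · exact Finset.insert_erase hmem

end LabelSet

open LabelSet CopiesModel

/-- The ordinal with index `i` in a small set of ordinals. -/
noncomputable abbrev shrinkOrd (s : Set Ordinal.{u}) [Small.{u} s] (i : Shrink.{u} s) :
    Ordinal.{u} :=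
  ((equivShrink s).symm i).1

theorem shrinkOrd_mem {s : Set Ordinal.{u}} [Small.{u} s] (i : Shrink.{u} s) :
    shrinkOrd s i ∈ s := ((equivShrink s).symm i).2

theorem shrinkOrd_injective (s : Set Ordinal.{u}) [Small.{u} s] :
    Function.Injective (shrinkOrd s) :=
  Subtype.val_injective.comp (equivShrink s).symm.injective

theorem exists_shrinkOrd_eq {s : Set Ordinal.{u}} [Small.{u} s] {a : Ordinal.{u}} (ha : a ∈ s) :
    ∃ i, shrinkOrd s i = a :=
  ⟨equivShrink s ⟨a, ha⟩, by simp [shrinkOrd]⟩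

/-! ### Splitting the index set by maximum and by label -/

section Decomposition

variable {α β : Ordinal.{u}}

/-- Decomposition of the finite sets of ordinals less than `α` according to the maximum. -/
noncomputable def splitH (hα : 0 < α) :
    FinSets.{u} 0 ⊕ (Σ i : Shrink.{u} (Set.Iio α), FinSets (shrinkOrd (Set.Iio α) i)) ≃
      FinSets α :=
  Equiv.ofBijective
    (Sum.elim (base hα.le) fun p => top (shrinkOrd _ p.1) (shrinkOrd_mem p.1) PUnit.unit
      (fun h => absurd rfl h) p.2) <| by
    constructor
    · rintro (x | ⟨i, x⟩) (y | ⟨j, y⟩) h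
      · exact congrArg _ (Subsingleton.elim _ _)
      · exact absurd (congrArg (color 0) h) (color_base_ne_top hα.le zero_le zero_le
          (shrinkOrd_mem j) _ (fun h => absurd rfl h) _ _)
      · exact absurd (congrArg (color 0) h.symm) (color_base_ne_top hα.le zero_le zero_le
          (shrinkOrd_mem i) _ (fun h => absurd rfl h) _ _)
      · obtain rfl := shrinkOrd_injective _ (color_top_ne_top zero_le zero_le
          (shrinkOrd_mem i) (shrinkOrd_mem j) _ _ (fun h => absurd rfl h)
              (fun h => absurd rfl h) _ _
          (congrArg (color 0) h))
        obtain rfl := top_injective (shrinkOrd_mem i) _ (fun h => absurd rfl h) h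
        rfl
    · intro y
      rcases hm : y.set.max with _ | a
      · obtain ⟨x, hx⟩ := exists_base hα.le (y := y) rfl (by rw [hm]; exact WithBot.bot_lt_coe _)
        exact ⟨Sum.inl x, hx⟩
      · have ha : a < α := WithBot.coe_lt_coe.1 (hm.symm.trans_lt y.max_lt)
        obtain ⟨i, rfl⟩ := exists_shrinkOrd_eq (s := Set.Iio α) ha
        obtain ⟨x, hx⟩ := exists_top ha (y := y) (fun h => absurd rfl h) rfl hm
        exact ⟨Sum.inr ⟨i, x⟩, hx⟩

/-- Decomposition of the labelled sets according to the label. -/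
noncomputable def splitD (hβα : β < α) :
    (FinSets α ⊕ FinSets β) ⊕ FinSets β ≃ LabelSet (0 : Fin 3) α β :=
  Equiv.ofBijective
    (Sum.elim (Sum.elim (base le_rfl) (top β hβα 1 fun _ => rfl)) (top β hβα 2 fun _ => rfl)) <| by
    constructor
    · rintro ((x | x) | x) ((y | y) | y) h
      · exact congrArg _ (congrArg _ (base_injective le_rfl h))
      · exact absurd (congrArg label h) (by simp [base, top])
      · exact absurd (congrArg label h) (by simp [base, top])
      · exact absurd (congrArg label h) (by simp [base, top])
      · exact congrArg _ (congrArg _ (top_injective hβα _ (fun _ => rfl) h))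
      · exact absurd (congrArg label h) (by simp [top])
      · exact absurd (congrArg label h) (by simp [base, top])
      · exact absurd (congrArg label h) (by simp [top])
      · exact congrArg _ (top_injective hβα _ (fun _ => rfl) h)
    · intro y
      have hl : y.label = 0 ∨ y.label = 1 ∨ y.label = 2 := by omega
      rcases hl with hl | hl | hl
      · obtain ⟨x, hx⟩ := exists_base le_rfl hl y.max_lt
        exact ⟨Sum.inl (Sum.inl x), hx⟩
      · obtain ⟨x, hx⟩ := exists_top hβα (fun _ => rfl) hl (y.max_eq (by simp [hl]))
        exact ⟨Sum.inl (Sum.inr x), hx⟩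
      · obtain ⟨x, hx⟩ := exists_top hβα (fun _ => rfl) hl (y.max_eq (by simp [hl]))
        exact ⟨Sum.inr x, hx⟩

/-- Decomposition of the labelled sets according to the maximum, where all maxima less than `β` are
treated together. -/
noncomputable def splitR (hβα : β < α) :
    (FinSets β ⊕ (Σ _ : Fin 3, FinSets β)) ⊕
      (Σ i : Shrink.{u} (Set.Ioo β α), FinSets (shrinkOrd (Set.Ioo β α) i)) ≃
      LabelSet (0 : Fin 3) α β :=
  Equiv.ofBijective
    (Sum.elim (Sum.elim (base hβα.le) fun p => top β hβα p.1 (fun _ => rfl) p.2)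
      fun p => top (shrinkOrd _ p.1) (shrinkOrd_mem p.1).2 0 (fun h => absurd rfl h) p.2) <| by
    constructor
    · rintro ((x | ⟨i, x⟩) | ⟨i, x⟩) ((y | ⟨j, y⟩) | ⟨j, y⟩) h
      · exact congrArg _ (congrArg _ (base_injective hβα.le h))
      · exact absurd (congrArg (color 0) h) (color_base_ne_top hβα.le le_rfl zero_le
          hβα _ (fun _ => rfl) _ _)
      · exact absurd (congrArg (color 0) h)
          (color_base_ne_top hβα.le (shrinkOrd_mem j).1.le zero_le
            (shrinkOrd_mem j).2 _ (fun h => absurd rfl h) _ _)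
      · exact absurd (congrArg (color 0) h.symm) (color_base_ne_top hβα.le le_rfl zero_le
          hβα _ (fun _ => rfl) _ _)
      · obtain rfl : i = j := congrArg label h
        obtain rfl := top_injective hβα _ (fun _ => rfl) h
        rfl
      · exact absurd (color_top_ne_top zero_le zero_le hβα (shrinkOrd_mem j).2 _ _ (fun _ => rfl)
          (fun h => absurd rfl h) _ _
          (congrArg (color 0) h))
          (shrinkOrd_mem j).1.ne
      · exact absurd (congrArg (color 0) h.symm)
          (color_base_ne_top hβα.le (shrinkOrd_mem i).1.le zero_le
            (shrinkOrd_mem i).2 _ (fun h => absurd rfl h) _ _)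
      · exact absurd (color_top_ne_top zero_le zero_le (shrinkOrd_mem i).2 hβα _ _
          (fun h => absurd rfl h) (fun _ => rfl) _ _
          (congrArg (color 0) h))
          (shrinkOrd_mem i).1.ne'
      · obtain rfl := shrinkOrd_injective _ (color_top_ne_top zero_le zero_le (shrinkOrd_mem i).2
          (shrinkOrd_mem j).2 _ _ (fun h => absurd rfl h) (fun h => absurd rfl h) _ _
          (congrArg (color 0) h))
        obtain rfl := top_injective (shrinkOrd_mem i).2 _ (fun h => absurd rfl h) h
        rfl
    · intro y
      rcases lt_trichotomy y.set.max β with hm | hm | hm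
      · have hl : y.label = 0 := by
          by_contra hl
          exact hm.ne (y.max_eq hl)
        obtain ⟨x, hx⟩ := exists_base hβα.le hl hm
        exact ⟨Sum.inl (Sum.inl x), hx⟩
      · obtain ⟨x, hx⟩ := exists_top hβα (fun _ => rfl) rfl hm
        exact ⟨Sum.inl (Sum.inr ⟨y.label, x⟩), hx⟩
      · have hl : y.label = 0 := by
          by_contra hl
          exact hm.ne' (y.max_eq hl)
        obtain ⟨a, ha⟩ := WithBot.ne_bot_iff_exists.1 (ne_bot_of_gt hm)
        have ha' : a ∈ Set.Ioo β α :=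
          ⟨WithBot.coe_lt_coe.1 (ha ▸ hm), WithBot.coe_lt_coe.1 (ha ▸ y.max_lt)⟩
        obtain ⟨i, rfl⟩ := exists_shrinkOrd_eq ha'
        obtain ⟨x, hx⟩ := exists_top ha'.2 (fun h => absurd rfl h) hl ha.symm
        exact ⟨Sum.inr ⟨i, x⟩, hx⟩

end Decomposition

/-! ### Identifying the groups with stages -/

section Main

variable {V : Type u} {Γ : SimpleGraph V}

theorem exists_represents_zero :
    ∃ m : CopiesModel Γ (⟨V, Γ, ⊤⟩ : PermGraph.{u}).graph (FinSets 0),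
      Represents (⟨V, Γ, ⊤⟩ : PermGraph.{u}) m (stage _ 0 0 0) := by
  refine ⟨⟨(Equiv.uniqueProd V (FinSets 0)).symm, fun a b => ?_⟩, fun σ => ?_⟩
  · simp
  · rw [Subsingleton.elim σ 1]
    exact ⟨fun _ => one_mem _, fun _ => Subgroup.mem_top _⟩

/-- With one label the tower that starts at stage 0 ends at stage `α`, the full isometry group of
the finite sets of ordinals below `α`. -/
theorem represents_towerF (hconn : Γ.Connected) (hrigid : IsRigid Γ) {α : Ordinal.{u}}
    {m : CopiesModel Γ (towerH Γ α).graph (FinSets α)}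
    (h : Represents (towerH Γ α) m (stage _ α 0 0)) :
    Represents (P := towerF Γ α) m (stage _ α 0 α) := by
  refine represents_of_grp_eq (P := towerF Γ α) hconn hrigid ?_
  have h1 : (towerF Γ α).grp = terminalGroup (towerH Γ α).grp := rfl
  rw [h1, h.grp_eq hconn hrigid, terminalGroup_map_stage_zero_of_subsingleton]
  rfl

/-- At stage `δ` a maximum of at least `δ` is still visible, so different factors keep different
colours. The case `δ = 0` serves the initial groups, and `δ = β` the terminal one. -/
theorem represents_prodF (hconn : Γ.Connected) (hrigid : IsRigid Γ) (s : Set Ordinal.{u})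
    [Small.{u} s] {m : ∀ i : Shrink.{u} s, CopiesModel Γ (towerH Γ (shrinkOrd s i)).graph
      (FinSets (shrinkOrd s i))}
    (hm : ∀ i, Represents (towerH Γ (shrinkOrd s i)) (m i) (stage _ _ 0 0))
    {ι : Type*} [DecidableEq ι] {i₀ : ι} {α β δ : Ordinal.{u}} (hs : ∀ a ∈ s, a < α ∧ δ ≤ a) :
    Represents (P := prodF Γ s) (CopiesModel.sigma m)
      (colorIsom (fun p => color δ (top (i₀ := i₀) (β := β) (shrinkOrd s p.1)
          (hs _ (shrinkOrd_mem p.1)).1 i₀ (fun h => absurd rfl h) p.2))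
        fun p q => dist (top (i₀ := i₀) (β := β) (shrinkOrd s p.1)
          (hs _ (shrinkOrd_mem p.1)).1 i₀ (fun h => absurd rfl h) p.2)
          (top (shrinkOrd s q.1) (hs _ (shrinkOrd_mem q.1)).1 i₀ (fun h => absurd rfl h) q.2)) := by
  refine Represents.sigma (P := fun i : Shrink.{u} s => towerF Γ (shrinkOrd s i)) (m := m)
    (fun i => represents_towerF hconn hrigid (hm i)) hconn hrigid ?_ ?_ ?_
  · exact fun i x y => ⟨fun _ => color_eq_of_self _ _, fun _ => color_top_eq _ _ _ _ _⟩
  · exact fun p q h => shrinkOrd_injective _ (color_top_ne_top (hs _ (shrinkOrd_mem _)).2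
      (hs _ (shrinkOrd_mem _)).2 _ _ _ _ _ _ _ _ h)
  · exact fun i x y _ => dist_top_same _ _ _ _ _

/-- Induction on `α`, sorting the finite sets by maximum: `∅` gives the factor `F_0`, and the sets
with maximum `γ` give `F_γ`, already known to be a full isometry group. -/
theorem exists_represents_towerH (hconn : Γ.Connected) (hrigid : IsRigid Γ) (α : Ordinal.{u}) :
    ∃ m : CopiesModel Γ (towerH Γ α).graph (FinSets α),
      Represents (towerH Γ α) m (stage _ α 0 0) := by
  induction α using WellFoundedLT.induction with
  | ind α ih =>
    rcases eq_or_ne α 0 with rfl | h0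
    · rw [towerH_zero]
      exact exists_represents_zero
    · have hα : 0 < α := pos_iff_ne_zero.2 h0
      rw [towerH_of_pos Γ hα]
      obtain ⟨m₀, hm₀⟩ := ih 0 hα
      choose m hm using fun i : Shrink.{u} (Set.Iio α) => ih (shrinkOrd _ i) (shrinkOrd_mem i)
      refine ⟨(CopiesModel.sum m₀ (CopiesModel.sigma m)).map (splitH hα), Represents.map _ ?_⟩
      refine Represents.sum (P := towerF Γ 0) (Q := prodF Γ (Set.Iio α))
        (represents_towerF hconn hrigid hm₀)
        (represents_prodF hconn hrigid (Set.Iio α) hm (i₀ := PUnit.unit) (α := α) (β := 0) (δ := 0)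
          fun a ha => ⟨ha, zero_le⟩) hconn hrigid ?_ ?_ ?_ ?_ ?_
      · exact fun x y => color_base_eq_iff hα.le _ _
      · exact fun _ _ => Iff.rfl
      · exact fun x y => color_base_ne_top hα.le zero_le zero_le
          (shrinkOrd_mem y.1) _ (fun h => absurd rfl h) _ _
      · exact fun x y _ => dist_base hα.le _ _
      · exact fun _ _ _ => rfl

end Main

theorem mainTheorem7 {V : Type u} (Γ : SimpleGraph V) (hconn : Γ.Connected) (hrigid : IsRigid Γ)
    (α β : Ordinal.{u}) (hβ : 1 ≤ β) (hβα : β < α) :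
    TerminatesInExactly (towerD Γ α β).grp β ∧
    ∃ φ : (towerD Γ α β).graph ≃g
        (((towerH Γ β).prod (PermGraph.pi fun _ : Fin 3 => towerF Γ β)).prod
          (prodF Γ (Set.Ioo β α))).graph,
      PermGraph.IsPermIso (P := towerD Γ α β)
        (Q := ((towerH Γ β).prod (PermGraph.pi fun _ : Fin 3 => towerF Γ β)).prod
          (prodF Γ (Set.Ioo β α))) φ ∧
      PermGraph.IsPermIso (P := (towerD Γ α β).terminal)
        (Q := ((towerF Γ β).prod ((towerF Γ β).wreathSym (Fin 3))).prod
          (prodF Γ (Set.Ioo β α))) φ := by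
  have hβ0 : β ≠ 0 := fun h => absurd (h ▸ hβ) (by simp)
  have hfin : ∀ i : Fin 3, ∃ j k, i ≠ j ∧ j ≠ k ∧ i ≠ k := by decide
  obtain ⟨mα, hα⟩ := exists_represents_towerH hconn hrigid α
  obtain ⟨mβ, hmβ⟩ := exists_represents_towerH hconn hrigid β
  choose m hm using fun i : Shrink.{u} (Set.Ioo β α) =>
    exists_represents_towerH hconn hrigid (shrinkOrd _ i)
  have hFβ := represents_towerF hconn hrigid hmβ
  let mD : CopiesModel Γ (towerD Γ α β).graph (LabelSet (0 : Fin 3) α β) :=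
    (CopiesModel.sum (CopiesModel.sum mα mβ) mβ).map (splitD hβα)
  -- Both sides are indexed by the same labelled sets, split by label in `mD` and by maximum in
  -- `mR`; `φ` matches copies with equal index.
  let mR : CopiesModel Γ (((towerH Γ β).prod (PermGraph.pi fun _ : Fin 3 => towerF Γ β)).prod
      (prodF Γ (Set.Ioo β α))).graph (LabelSet (0 : Fin 3) α β) :=
    (CopiesModel.sum (CopiesModel.sum mβ (CopiesModel.sigma fun _ : Fin 3 => mβ))
      (CopiesModel.sigma m)).map (splitR hβα)
  have hD : Represents (towerD Γ α β) mD (stage 0 α β 0) := by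
    refine Represents.map _ ?_
    refine Represents.sum (P := (towerH Γ α).prod (towerF Γ β)) (Q := towerF Γ β)
      (c₁ := fun x => color 0 (splitD hβα (Sum.inl x)))
      (d₁ := fun x y => dist (splitD hβα (Sum.inl x)) (splitD hβα (Sum.inl y)))
      (Represents.sum (P := towerH Γ α) (Q := towerF Γ β) hα hFβ hconn hrigid ?_ ?_ ?_ ?_ ?_)
      hFβ hconn hrigid ?_ ?_ ?_ ?_ ?_
    · exact fun x y => color_base_eq_iff le_rfl _ _
    · exact fun x y => ⟨fun _ => color_eq_of_self _ _, fun _ => color_top_eq hβα _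
        (fun _ => rfl) _ _⟩
    · exact fun x y h => absurd (show (0 : Fin 3) = 1 from (color_eq_iff.1 h).1 rfl) (by decide)
    · exact fun x y _ => dist_base le_rfl _ _
    · exact fun x y _ => dist_top_same hβα _ (fun _ => rfl) _ _
    · exact fun _ _ => Iff.rfl
    · exact fun x y => ⟨fun _ => color_eq_of_self _ _, fun _ => color_top_eq hβα _
        (fun _ => rfl) _ _⟩
    · rintro (x | x) y h
      · exact absurd (show (0 : Fin 3) = 2 from (color_eq_iff.1 h).1 rfl) (by decide)
      · exact absurd (show (1 : Fin 3) = 2 from (color_eq_iff.1 h).1 rfl) (by decide)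
    · exact fun _ _ _ => rfl
    · exact fun x y _ => dist_top_same hβα _ (fun _ => rfl) _ _
  have hDt : Represents (P := (towerD Γ α β).terminal) mD (stage 0 α β β) := by
    refine represents_of_grp_eq (P := (towerD Γ α β).terminal) hconn hrigid ?_
    have h1 : (towerD Γ α β).terminal.grp = terminalGroup (towerD Γ α β).grp := rfl
    rw [h1, hD.grp_eq hconn hrigid, terminalGroup_map_stage_zero _ hβ0 hβα.le hfin]
    rfl
  have hR : Represents _ mR (stage 0 α β 0) := by
    refine Represents.map _ ?_
    refine Represents.sum (P := (towerH Γ β).prod (PermGraph.pi fun _ : Fin 3 => towerF Γ β))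
      (Q := prodF Γ (Set.Ioo β α))
      (c₁ := fun x => color 0 (splitR hβα (Sum.inl x)))
      (d₁ := fun x y => dist (splitR hβα (Sum.inl x)) (splitR hβα (Sum.inl y)))
      (Represents.sum (P := towerH Γ β) (Q := PermGraph.pi fun _ : Fin 3 => towerF Γ β)
        (c₂ := fun x => color 0 (splitR hβα (Sum.inl (Sum.inr x))))
        (d₂ := fun x y => dist (splitR hβα (Sum.inl (Sum.inr x)))
          (splitR hβα (Sum.inl (Sum.inr y))))
        hmβ (Represents.sigma (P := fun _ : Fin 3 => towerF Γ β) (fun _ => hFβ) hconn hrigid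
          ?_ ?_ ?_) hconn hrigid ?_ ?_ ?_ ?_ ?_)
      (represents_prodF hconn hrigid (Set.Ioo β α) hm (i₀ := (0 : Fin 3)) (α := α) (β := β)
        (δ := 0) fun a ha => ⟨ha.2, zero_le⟩) hconn hrigid ?_ ?_ ?_ ?_ ?_
    · exact fun i x y => ⟨fun _ => color_eq_of_self _ _, fun _ => color_top_eq hβα _
        (fun _ => rfl) _ _⟩
    · exact fun p q h => (color_eq_iff.1 h).1 rfl
    · exact fun i x y _ => dist_top_same hβα _ (fun _ => rfl) _ _
    · exact fun x y => color_base_eq_iff hβα.le _ _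
    · exact fun _ _ => Iff.rfl
    · exact fun x y => color_base_ne_top hβα.le le_rfl zero_le hβα _ (fun _ => rfl) _ _
    · exact fun x y _ => dist_base hβα.le _ _
    · exact fun _ _ _ => rfl
    · exact fun _ _ => Iff.rfl
    · exact fun _ _ => Iff.rfl
    · rintro (x | x) y h
      · exact color_base_ne_top hβα.le (shrinkOrd_mem y.1).1.le zero_le
          (shrinkOrd_mem y.1).2 _ (fun h => absurd rfl h) _ _ h
      · exact (shrinkOrd_mem y.1).1.ne (color_top_ne_top zero_le zero_le hβα
          (shrinkOrd_mem y.1).2 _ _ (fun _ => rfl) (fun h => absurd rfl h) _ _ h)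
    · exact fun _ _ _ => rfl
    · exact fun _ _ _ => rfl
  have hRt : Represents (P := ((towerF Γ β).prod ((towerF Γ β).wreathSym (Fin 3))).prod
      (prodF Γ (Set.Ioo β α))) mR (stage 0 α β β) := by
    refine Represents.map (P := ((towerF Γ β).prod ((towerF Γ β).wreathSym (Fin 3))).prod
      (prodF Γ (Set.Ioo β α))) _ ?_
    refine Represents.sum (P := (towerF Γ β).prod ((towerF Γ β).wreathSym (Fin 3)))
      (Q := prodF Γ (Set.Ioo β α))
      (c₁ := fun x => color β (splitR hβα (Sum.inl x)))
      (d₁ := fun x y => dist (splitR hβα (Sum.inl x)) (splitR hβα (Sum.inl y)))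
      (Represents.sum (P := towerF Γ β) (Q := (towerF Γ β).wreathSym (Fin 3))
        (c₂ := fun x => color β (splitR hβα (Sum.inl (Sum.inr x))))
        (d₂ := fun x y => dist (splitR hβα (Sum.inl (Sum.inr x)))
          (splitR hβα (Sum.inl (Sum.inr y))))
        -- The three families of sets of maximum `β` are at mutual distance `β`, a value not
        -- attained inside a family; this makes the factor a wreath product.
        hFβ (Represents.wreathSym (I := Fin 3) (P := towerF Γ β) (b := (β : WithBot Ordinal.{u}))
          hFβ hconn hrigid ?_ ?_ ?_ ?_ ?_) hconn hrigid ?_ ?_ ?_ ?_ ?_)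
      (represents_prodF hconn hrigid (Set.Ioo β α) hm (i₀ := (0 : Fin 3)) (α := α) (β := β)
        (δ := β) fun a ha => ⟨ha.2, ha.1.le⟩) hconn hrigid ?_ ?_ ?_ ?_ ?_
    · exact fun x y => color_eq_of_self _ _
    · exact fun p q => color_eq_iff.2 ⟨fun h => absurd h hβ0,
        congrArg (cut β) ((top_max hβα _ (fun _ => rfl) _).trans (top_max hβα _
            (fun _ => rfl) _).symm)⟩
    · exact fun i x y => dist_top_same hβα _ (fun _ => rfl) _ _
    · exact fun x y => dist_ne_coe _ _
    · exact fun i j x y h => dist_top_ne hβα h (fun _ => rfl) (fun _ => rfl) _ _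
    · exact fun x y => color_base_eq_iff hβα.le _ _
    · exact fun _ _ => Iff.rfl
    · exact fun x y => color_base_ne_top hβα.le le_rfl le_rfl hβα _ (fun _ => rfl) _ _
    · exact fun x y _ => dist_base hβα.le _ _
    · exact fun _ _ _ => rfl
    · exact fun _ _ => Iff.rfl
    · exact fun _ _ => Iff.rfl
    · rintro (x | x) y h
      · exact color_base_ne_top hβα.le (shrinkOrd_mem y.1).1.le (shrinkOrd_mem y.1).1.le
          (shrinkOrd_mem y.1).2 _ (fun h => absurd rfl h) _ _ h
      · exact (shrinkOrd_mem y.1).1.ne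
          (color_top_ne_top le_rfl (shrinkOrd_mem y.1).1.le hβα
            (shrinkOrd_mem y.1).2 _ _ (fun _ => rfl) (fun h => absurd rfl h) _ _ h)
    · exact fun _ _ _ => rfl
    · exact fun _ _ _ => rfl
  -- One isomorphism serves both claims, since the initial groups are both stage 0 and the final
  -- groups both stage `β` in the same two models.
  refine ⟨?_, mD.iso mR, hD.isPermIso hR hconn hrigid, ?_⟩
  · rw [hD.grp_eq hconn hrigid]
    exact terminatesInExactly_map_stage_zero _ hβ0 hβα.le hfin
  · exact Represents.isPermIso (P := (towerD Γ α β).terminal)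
      (Q := ((towerF Γ β).prod ((towerF Γ β).wreathSym (Fin 3))).prod (prodF Γ (Set.Ioo β α)))
      hDt hRt hconn hrigid
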